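/- Let $\Omega\subset\mathbb R^3$ be a polyhedral domain, that is, a bounded, connected, non-empty open set with $\operatorname{int}\overline\Omega=\Omega$ whose closure is a finite union of tetrahedra, and let $\mathcal T_h=\{T_1,\dots,T_{n_t}\}$ be a conforming tetrahedral grid on $\Omega$: the $T_k$ are non-degenerate closed tetrahedra with pairwise different vertex sets, $\bigcup_k T_k=\overline\Omega$, and any two different ones meet exactly in the convex hull of their common vertices. Let the four vertices of each $T\in\mathcal T_h$ be numbered, in an arbitrary way, $a_0,a_1,a_2,a_3$. Let $\hat{\mathbf b}=(\hat b_1,\hat b_2,\hat b_3)$ be the polynomial vector field of degree $4$ on the reference tetrahedron with vertices $0,e_1,e_2,e_3$ given by $$\begin{aligned}\hat b_1={}&\tfrac{263}{12}x^4+38x^3y+\tfrac{265}{3}x^3z+29x^2y^2+96x^2yz+\tfrac{209}{2}x^2z^2-16xy^3+42xy^2z+42xyz^2+\tfrac{103}{3}xz^3+\tfrac76y^4-y^2z^2-\tfrac{335}{12}z^4-\tfrac{253}{6}x^3\\&-\tfrac{87}{2}x^2y-119x^2z+\tfrac{21}{2}xy^2-56xyz-65xz^2+\tfrac{112}{3}z^3+\tfrac{703}{28}x^2+\tfrac72xy+\tfrac{251}{7}xz-\tfrac{41}{28}y^2+\tfrac27yz-\tfrac{169}{14}z^2-\tfrac{181}{42}x+\tfrac{13}{21}y+\tfrac{73}{840},\\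 \hat b_2={}&-\tfrac{233}{3}x^3y+\tfrac{67}{9}x^3z-\tfrac{233}{2}x^2y^2-235x^2yz+\tfrac{163}{6}x^2z^2-\tfrac{203}{3}xy^3-225xy^2z-209xyz^2+\tfrac{301}{9}xz^3-\tfrac{64}{3}y^3z-21y^2z^2-\tfrac{16}{3}yz^3\\&+\tfrac{113}{18}x^3+\tfrac{1105}{8}x^2y+\tfrac{155}{24}x^2z+\tfrac{1025}{8}xy^2+\tfrac{1077}{4}xyz-\tfrac{469}{24}xz^2+\tfrac{79}{8}y^3+\tfrac{417}{8}y^2z+\tfrac{289}{8}yz^2-\tfrac{199}{72}z^3-\tfrac{625}{56}x^2-\tfrac{505}{7}xy\\&-\tfrac{94}{7}xz-\tfrac{447}{28}y^2-\tfrac{251}{7}yz+\tfrac{317}{56}x+\tfrac{625}{84}y+\tfrac{101}{42}z-\tfrac{383}{630},\\ \hat b_3={}&-10x^3y-10x^3z+x^2y^2+119x^2yz-15x^2z^2+16xy^3+145xy^2z+129xyz^2+16y^3z+11y^2z^2-\tfrac{29}{4}z^4-\tfrac{93}{8}x^2y\\&-\tfrac{61}{8}x^2z-\tfrac{301}{8}xy^2-\tfrac{693}{4}xyz-\tfrac{141}{8}xz^2-\tfrac{13}{4}y^3-\tfrac{321}{8}y^2z-\tfrac{193}{8}yz^2+\tfrac{77}{8}z^3+\tfrac{181}{56}x^2+\tfrac{363}{14}xy+\tfrac{307}{14}xz+\tfrac{389}{56}y^2\\&+\tfrac{199}{7}yz-\tfrac{563}{168}x-\tfrac{33}{8}y-\tfrac{263}{84}z+\tfrac{103}{210}.\end{aligned}$$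 For $T\in\mathcal T_h$ and $i=1,\dots,9$ let $F_{T,i}$ be the affine map that sends $0,e_1,e_2,e_3$ to $a_{\sigma_i(0)},a_{\sigma_i(1)},a_{\sigma_i(2)},a_{\sigma_i(3)}$, where $\sigma_1,\dots,\sigma_9$ are the permutations $0123,\,0231,\,0312,\,1203,\,1032,\,1320,\,2013,\,2301,\,3021$ (listed by their values), let $J_{T,i}$ be its Jacobi matrix, and let $\mathbf b_{T,i}(\mathbf x)=J_{T,i}\,\hat{\mathbf b}(F_{T,i}^{-1}(\mathbf x))$ on (the interior of) $T$, extended by zero elsewhere. Put $$\mathbf V_h=\Big\{\mathbf v_c+\sum_{T\in\mathcal T_h}\sum_{i=1}^9 d_{T,i}\,\mathbf b_{T,i}\ :\ \mathbf v_c\in C(\overline\Omega)^3,\ \mathbf v_c|_T\in P_3(T)^3\ \ \forall T\in\mathcal T_h,\ \mathbf v_c|_{\partial\Omega}=\mathbf 0,\ d_{T,i}\in\mathbb R\Big\},$$ $$P_h=\Big\{p_h\in L^2(\Omega)\ :\ \int_\Omega p_h=0,\ \ p_h|_T\in P_2(T)\ \ \forall T\in\mathcal T_h\Big\},$$ where $P_k(T)$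 denotes the polynomials of total degree at most $k$ on $T$. Write $(\cdot,\cdot)$ for the $L^2(\Omega)$ inner product, with the gradient and the divergence of functions in $\mathbf V_h$ taken tetrahedron by tetrahedron. Then for every $\mathbf f\in L^2(\Omega)^3$ there is exactly one pair $(\mathbf u_h,p_h)\in\mathbf V_h\times P_h$ such that $$(\nabla\mathbf u_h,\nabla\mathbf v_h)-(\operatorname{div}\mathbf v_h,p_h)=(\mathbf f,\mathbf v_h)\quad\forall\,\mathbf v_h\in\mathbf V_h,\qquad(\operatorname{div}\mathbf u_h,q_h)=0\quad\forall\,q_h\in P_h.$$ -/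

import Mathlib

open MeasureTheory

noncomputable section

/-- Euclidean three-space. -/
abbrev E3 : Type := EuclideanSpace ℝ (Fin 3)

/-- A (conforming) tetrahedral grid `T_1, …, T_{n_t}` on the domain `Ω`. Every tetrahedron carries
a numbering of its four vertices; the grid is an arbitrary one, with arbitrary numberings. Two
different tetrahedra have different vertex sets, and they meet exactly in the (possibly empty)
common face spanned by their common vertices. -/
structure TetMesh (Ω : Set E3) where
  /-- the number of tetrahedra -/
  nt : ℕ
  /-- the numbered vertices of the tetrahedra -/
  vertex : Fin nt → Fin 4 → E3
  affineIndependent : ∀ T, AffineIndependent ℝ (vertex T)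
  range_ne : ∀ T T', T ≠ T' → Set.range (vertex T) ≠ Set.range (vertex T')
  inter_eq : ∀ T T', T ≠ T' →
    convexHull ℝ (Set.range (vertex T)) ∩ convexHull ℝ (Set.range (vertex T')) =
      convexHull ℝ (Set.range (vertex T) ∩ Set.range (vertex T'))
  cover : (⋃ T, convexHull ℝ (Set.range (vertex T))) = closure Ω

/-- First component of the reference bubble, in the coordinates of the reference tetrahedron. -/
def refBubble1 (x y z : ℝ) : ℝ :=
  263 / 12 * x ^ 4 + 38 * x ^ 3 * y + 265 / 3 * x ^ 3 * z
    + 29 * x ^ 2 * y ^ 2 + 96 * x ^ 2 * y * z + 209 / 2 * x ^ 2 * z ^ 2 - 16 * x * y ^ 3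
    + 42 * x * y ^ 2 * z + 42 * x * y * z ^ 2 + 103 / 3 * x * z ^ 3
    + 7 / 6 * y ^ 4 - y ^ 2 * z ^ 2 - 335 / 12 * z ^ 4 - 253 / 6 * x ^ 3
    - 87 / 2 * x ^ 2 * y - 119 * x ^ 2 * z + 21 / 2 * x * y ^ 2 - 56 * x * y * z
    - 65 * x * z ^ 2 + 112 / 3 * z ^ 3 + 703 / 28 * x ^ 2
    + 7 / 2 * x * y + 251 / 7 * x * z - 41 / 28 * y ^ 2
    + 2 / 7 * y * z - 169 / 14 * z ^ 2
    - 181 / 42 * x + 13 / 21 * y + 73 / 840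

/-- Second component of the reference bubble. -/
def refBubble2 (x y z : ℝ) : ℝ :=
  -(233 / 3) * x ^ 3 * y + 67 / 9 * x ^ 3 * z - 233 / 2 * x ^ 2 * y ^ 2
    - 235 * x ^ 2 * y * z + 163 / 6 * x ^ 2 * z ^ 2 - 203 / 3 * x * y ^ 3
    - 225 * x * y ^ 2 * z - 209 * x * y * z ^ 2 + 301 / 9 * x * z ^ 3
    - 64 / 3 * y ^ 3 * z - 21 * y ^ 2 * z ^ 2 - 16 / 3 * y * z ^ 3
    + 113 / 18 * x ^ 3 + 1105 / 8 * x ^ 2 * y + 155 / 24 * x ^ 2 * z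
    + 1025 / 8 * x * y ^ 2 + 1077 / 4 * x * y * z - 469 / 24 * x * z ^ 2
    + 79 / 8 * y ^ 3 + 417 / 8 * y ^ 2 * z + 289 / 8 * y * z ^ 2
    - 199 / 72 * z ^ 3 - 625 / 56 * x ^ 2 - 505 / 7 * x * y
    - 94 / 7 * x * z - 447 / 28 * y ^ 2
    - 251 / 7 * y * z + 317 / 56 * x + 625 / 84 * y + 101 / 42 * z - 383 / 630

/-- Third component of the reference bubble. -/
def refBubble3 (x y z : ℝ) : ℝ :=
  -10 * x ^ 3 * y - 10 * x ^ 3 * z + x ^ 2 * y ^ 2 + 119 * x ^ 2 * y * z - 15 * x ^ 2 * z ^ 2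
    + 16 * x * y ^ 3
    + 145 * x * y ^ 2 * z + 129 * x * y * z ^ 2 + 16 * y ^ 3 * z + 11 * y ^ 2 * z ^ 2
    - 29 / 4 * z ^ 4 - 93 / 8 * x ^ 2 * y
    - 61 / 8 * x ^ 2 * z - 301 / 8 * x * y ^ 2 - 693 / 4 * x * y * z
    - 141 / 8 * x * z ^ 2 - 13 / 4 * y ^ 3 - 321 / 8 * y ^ 2 * z
    - 193 / 8 * y * z ^ 2 + 77 / 8 * z ^ 3 + 181 / 56 * x ^ 2
    + 363 / 14 * x * y + 307 / 14 * x * z + 389 / 56 * y ^ 2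
    + 199 / 7 * y * z - 563 / 168 * x - 33 / 8 * y - 263 / 84 * z
    + 103 / 210

/-- The `P₄` bubble on the reference tetrahedron with vertices `0, e₁, e₂, e₃`. -/
def refBubble (s : Fin 3 → ℝ) : Fin 3 → ℝ :=
  ![refBubble1 (s 0) (s 1) (s 2), refBubble2 (s 0) (s 1) (s 2), refBubble3 (s 0) (s 1) (s 2)]

/-- The nine renumberings of the vertices of a tetrahedron. In terms of vertices named
`1, 6, 7, 2` (in this order) they are
`1672, 1726, 1267, 6712, 6127, 6271, 7162, 7216, 2176`. -/
def renumbering : Fin 9 → Fin 4 → Fin 4 :=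
  ![![0, 1, 2, 3], ![0, 2, 3, 1], ![0, 3, 1, 2],
    ![1, 2, 0, 3], ![1, 0, 3, 2], ![1, 3, 2, 0],
    ![2, 0, 1, 3], ![2, 3, 0, 1], ![3, 0, 2, 1]]

/-- The Jacobi matrix of the affine map that sends `0, e₁, e₂, e₃` to `a 0, a 1, a 2, a 3`. -/
def jacobiMatrix (a : Fin 4 → E3) : Matrix (Fin 3) (Fin 3) ℝ :=
  Matrix.of fun m k => a k.succ m - a 0 m

/-- The mapped bubble `x ↦ J b̂(F⁻¹ x)`, where `F s = a 0 + J s` is the affine map that sends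
`0, e₁, e₂, e₃` to `a 0, a 1, a 2, a 3`. -/
def mappedBubble (a : Fin 4 → E3) (x : E3) : E3 :=
  WithLp.toLp 2 (Matrix.mulVec (jacobiMatrix a)
    (refBubble (Matrix.mulVec (jacobiMatrix a)⁻¹ (WithLp.ofLp (x - a 0)))))

/-- The classical divergence of a vector field at a point. -/
def divAt (v : E3 → E3) (x : E3) : ℝ :=
  ∑ j : Fin 3, (fderiv ℝ v x (EuclideanSpace.single j 1)) j

/-- The Frobenius product `∇u : ∇v` at a point. -/
def gradInnerAt (u v : E3 → E3) (x : E3) : ℝ :=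
  ∑ i : Fin 3, ∑ j : Fin 3,
    (fderiv ℝ u x (EuclideanSpace.single j 1)) i * (fderiv ℝ v x (EuclideanSpace.single j 1)) i

namespace TetMesh

variable {Ω : Set E3} (M : TetMesh Ω)

/-- The closed tetrahedron number `T`. -/
def tet (T : Fin M.nt) : Set E3 := convexHull ℝ (Set.range (M.vertex T))

/-- The bubble `b_i` of the tetrahedron `T`, extended by zero outside `T`. (On the faces of the
grid, a null set, the value zero is a convention.) -/
def bubble (T : Fin M.nt) (i : Fin 9) : E3 → E3 :=
  (interior (M.tet T)).indicator (mappedBubble fun k => M.vertex T (renumbering i k))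

/-- The conforming vector `P₃` functions on the grid, i.e. the continuous functions on `closure Ω`
that are componentwise polynomials of degree at most `3` on every tetrahedron, with zero boundary
values. They are extended by zero outside `Ω`. -/
def conformingP3 : Submodule ℝ (E3 → E3) where
  carrier := {v | ContinuousOn v (closure Ω) ∧ (∀ x, x ∉ Ω → v x = 0) ∧
    ∀ T, ∀ m : Fin 3, ∃ q ∈ MvPolynomial.restrictTotalDegree (Fin 3) ℝ 3,
      ∀ x ∈ M.tet T, v x m = MvPolynomial.eval (fun k => x k) q}
  zero_mem' := ⟨continuousOn_const, fun _ _ => rfl, fun _ _ => ⟨0, Submodule.zero_mem _, by simp⟩⟩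
  add_mem' := by
    rintro u v ⟨hu, hu0, hup⟩ ⟨hv, hv0, hvp⟩
    refine ⟨hu.add hv, fun x hx => by simp [hu0 x hx, hv0 x hx], fun T m => ?_⟩
    obtain ⟨p, hp, hpe⟩ := hup T m
    obtain ⟨q, hq, hqe⟩ := hvp T m
    exact ⟨p + q, Submodule.add_mem _ hp hq, fun x hx => by simp [hpe x hx, hqe x hx]⟩
  smul_mem' := by
    rintro c v ⟨hv, hv0, hvp⟩
    refine ⟨hv.const_smul c, fun x hx => by simp [hv0 x hx], fun T m => ?_⟩
    obtain ⟨q, hq, hqe⟩ := hvp T m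
    exact ⟨c • q, Submodule.smul_mem _ c hq, fun x hx => by simp [hqe x hx]⟩

/-- The velocity space `V_h`: the sums `v_c + v_b` of a conforming `P₃` function `v_c` with zero
boundary values and a linear combination `v_b` of the nine bubbles of all tetrahedra. -/
def velocitySpace : Submodule ℝ (E3 → E3) :=
  M.conformingP3 ⊔
    Submodule.span ℝ (Set.range fun Ti : Fin M.nt × Fin 9 => M.bubble Ti.1 Ti.2)

/-- The pressure space `P_h`: the functions in `L²(Ω)` of mean value zero that are polynomials of
degree at most `2` on every tetrahedron. -/
def pressureSpace : Submodule ℝ (Lp ℝ 2 (volume.restrict Ω)) where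
  carrier := {p | (Integrable p (volume.restrict Ω) ∧ ∫ x in Ω, p x = 0) ∧
    ∀ T, ∃ q ∈ MvPolynomial.restrictTotalDegree (Fin 3) ℝ 2,
      ∀ᵐ x ∂(volume.restrict Ω), x ∈ M.tet T → p x = MvPolynomial.eval (fun k => x k) q}
  zero_mem' := by
    have h := Lp.coeFn_zero ℝ 2 (volume.restrict Ω)
    refine ⟨⟨(integrable_zero _ _ _).congr h.symm, ?_⟩, fun T => ⟨0, Submodule.zero_mem _, ?_⟩⟩
    · rw [integral_congr_ae h]; simp
    · filter_upwards [h] with x hx _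
      rw [hx]; simp
  add_mem' := by
    rintro p p' ⟨⟨hi, h0⟩, hp⟩ ⟨⟨hi', h0'⟩, hp'⟩
    have h := Lp.coeFn_add p p'
    refine ⟨⟨(hi.add hi').congr h.symm, ?_⟩, fun T => ?_⟩
    · rw [integral_congr_ae h]
      simp only [Pi.add_apply]
      rw [integral_add hi hi', h0, h0', add_zero]
    · obtain ⟨q, hq, hqe⟩ := hp T
      obtain ⟨q', hq', hqe'⟩ := hp' T
      refine ⟨q + q', Submodule.add_mem _ hq hq', ?_⟩
      filter_upwards [h, hqe, hqe'] with x hx hx1 hx2 hxT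
      rw [hx]; simp [hx1 hxT, hx2 hxT]
  smul_mem' := by
    rintro c p ⟨⟨hi, h0⟩, hp⟩
    have h := Lp.coeFn_smul c p
    refine ⟨⟨(hi.smul c).congr h.symm, ?_⟩, fun T => ?_⟩
    · rw [integral_congr_ae h]
      simp only [Pi.smul_apply]
      rw [integral_smul, h0, smul_zero]
    · obtain ⟨q, hq, hqe⟩ := hp T
      refine ⟨c • q, Submodule.smul_mem _ c hq, ?_⟩
      filter_upwards [h, hqe] with x hx hx1 hxT
      rw [hx]; simp [hx1 hxT]

/-- The broken form `(∇u, ∇v)`, computed tetrahedron by tetrahedron. -/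
def gradForm (u v : E3 → E3) : ℝ :=
  ∑ T, ∫ x in interior (M.tet T), gradInnerAt u v x

/-- The broken form `(div v, p)`, computed tetrahedron by tetrahedron. -/
def divForm (v : E3 → E3) (p : E3 → ℝ) : ℝ :=
  ∑ T, ∫ x in interior (M.tet T), divAt v x * p x

/-- `(u, p)` solves the discrete Stokes equations with right-hand side `f`:
`(∇u, ∇v) - (div v, p) = (f, v)` for all `v ∈ V_h`, and `(div u, q) = 0` for all `q ∈ P_h`. -/
def IsDiscreteStokesSolution (f : Lp E3 2 (volume.restrict Ω))
    (u : M.velocitySpace) (p : M.pressureSpace) : Prop :=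
  (∀ v ∈ M.velocitySpace,
    M.gradForm u v - M.divForm v (p : Lp ℝ 2 (volume.restrict Ω)) =
      ∫ x in Ω, inner ℝ (f x) (v x)) ∧
  (∀ q ∈ M.pressureSpace, M.divForm u q = 0)

end TetMesh

end

/-!
The system is a saddle point problem on finite-dimensional spaces, so it suffices that
`(∇u, ∇u) = 0` forces `u = 0` and that `(div v, p) = 0` for all `v` forces `p = 0`.

If `(∇u, ∇u) = 0`, then `u` is constant on every tetrahedron, and since the quartic parts of the
nine bubbles of a tetrahedron are linearly independent, the bubble part of `u` vanishes. So `u` is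
continuous and piecewise constant with zero boundary values, hence zero.

If `p` is orthogonal to all divergences, the nine bubbles of a tetrahedron already force `p` to be
constant on it: the moments of their divergences against products of barycentric coordinates
annihilate, among the symmetric coefficient matrices, only the constants. For two tetrahedra with a
common face, the conforming field that equals the cubic bubble of the face times a constant vector
has opposite nonzero fluxes into them, so `p` takes the same constant on both. As removing finitely
many lines does not disconnect `Ω`, any two tetrahedra are joined by a chain with common faces; thus
`p` is constant, and its mean is zero.
-/

section LinearAlgebra

variable {K V P : Type*} [Field K] [AddCommGroup V] [Module K V] [AddCommGroup P] [Module K P]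

theorem existsUnique_saddlePoint [FiniteDimensional K V] [FiniteDimensional K P]
    (A : V →ₗ[K] V →ₗ[K] K) (B : V →ₗ[K] P →ₗ[K] K) (F : V →ₗ[K] K)
    (hA : ∀ u, A u u = 0 → u = 0) (hB : ∀ p, (∀ v, B v p = 0) → p = 0) :
    ∃! up : V × P, (∀ v, A up.1 v - B v up.2 = F v) ∧ ∀ q, B up.1 q = 0 := by
  let Φ : V × P →ₗ[K] Module.Dual K V × Module.Dual K P :=
    ((A ∘ₗ LinearMap.fst K V P) - (B.flip ∘ₗ LinearMap.snd K V P)).prod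
      (B ∘ₗ LinearMap.fst K V P)
  have hinj : Function.Injective Φ := by
    rw [injective_iff_map_eq_zero]
    rintro ⟨u, p⟩ h
    have hmomentum (v : V) : A u v - B v p = 0 := LinearMap.congr_fun (congrArg Prod.fst h) v
    have hdiv (q : P) : B u q = 0 := LinearMap.congr_fun (congrArg Prod.snd h) q
    obtain rfl : u = 0 := hA u (by simpa [hdiv p] using hmomentum u)
    obtain rfl : p = 0 := hB p fun v => by simpa using hmomentum v
    rfl
  have hsurj : Function.Surjective Φ :=
    (LinearMap.injective_iff_surjective_of_finrank_eq_finrank (by simp)).1 hinj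
  have hiff (up : V × P) :
      ((∀ v, A up.1 v - B v up.2 = F v) ∧ ∀ q, B up.1 q = 0) ↔ Φ up = (F, 0) := by
    rw [Prod.ext_iff, LinearMap.ext_iff, LinearMap.ext_iff]
    rfl
  simpa only [hiff] using (Function.bijective_iff_existsUnique Φ).1 ⟨hinj, hsurj⟩ (F, 0)

theorem finiteDimensional_of_linearRelation [FiniteDimensional K V] (R : Submodule K (V × P))
    (hR : ∀ p, (0, p) ∈ R → p = 0) (S : Submodule K P) (hS : ∀ p ∈ S, ∃ v, (v, p) ∈ R) :
    FiniteDimensional K S := by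
  have hinj : Function.Injective (LinearMap.fst K V P ∘ₗ R.subtype) := by
    rw [injective_iff_map_eq_zero]
    rintro ⟨⟨v, p⟩, h⟩ (rfl : v = 0)
    obtain rfl := hR p h
    rfl
  have : FiniteDimensional K R := FiniteDimensional.of_injective _ hinj
  refine Submodule.finiteDimensional_of_le (S₂ := R.map (LinearMap.snd K V P)) fun p hp => ?_
  obtain ⟨v, hv⟩ := hS p hp
  exact ⟨(v, p), hv, rfl⟩

end LinearAlgebra

section Connectedness

open Module Set Topology

variable {X E ι α : Type*} [TopologicalSpace X] [NormedAddCommGroup E] [NormedSpace ℝ E]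

theorem eq_of_isPreconnected_of_closed_cover [Finite ι] {S : Set X} (hS : IsPreconnected S)
    {A : ι → Set X} (hA : ∀ i, IsClosed (A i)) (hcov : S ⊆ ⋃ i, A i) {c : ι → α}
    (hc : ∀ x ∈ S, ∀ i j, x ∈ A i → x ∈ A j → c i = c j) {i j : ι}
    (hi : (S ∩ A i).Nonempty) (hj : (S ∩ A j).Nonempty) : c i = c j := by
  obtain ⟨x, hxS, hxi⟩ := hi
  obtain ⟨y, hyS, hyj⟩ := hj
  refine hS.induction₂ (fun x y => ∀ i j, x ∈ A i → y ∈ A j → c i = c j) (fun x hx => ?_)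
    (fun x y z _ hy _ hxy hyz i j hi hj => ?_) (fun x y _ _ h i j hi hj => (h j i hj hi).symm)
    hxS hyS i j hxi hyj
  · have hnear : ∀ᶠ y in 𝓝[S] x, ∀ j, y ∈ A j → x ∈ A j := by
      refine nhdsWithin_le_nhds (Filter.eventually_all.2 fun j => ?_)
      by_cases hxj : x ∈ A j
      · exact Filter.Eventually.of_forall fun _ _ => hxj
      · filter_upwards [(hA j).isOpen_compl.mem_nhds hxj] with y hy hyj using absurd hyj hy
    filter_upwards [hnear] with y hy i j hi hj using hc x hx i j hi (hy j hj)
  · obtain ⟨k, hk⟩ := mem_iUnion.1 (hcov hy)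
    exact (hxy i k hi hk).trans (hyz k j hk hj)

theorem isPreconnected_diff_of_locally {U N : Set X} (hc : IsPreconnected U)
    (hN : Dense Nᶜ)
    (hloc : ∀ x ∈ U, ∃ B ⊆ U, IsOpen B ∧ x ∈ B ∧ IsPreconnected (B \ N)) :
    IsPreconnected (U \ N) := by
  choose! B hBU hBo hxB hBN using hloc
  refine isPreconnected_of_forall_pair fun x hx y hy => ?_
  suffices h : ∃ t, IsPreconnected t ∧ t ⊆ U \ N ∧ B x \ N ⊆ t ∧ B y \ N ⊆ t by
    obtain ⟨t, ht, htU, hxt, hyt⟩ := h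
    exact ⟨t, htU, hxt ⟨hxB x hx.1, hx.2⟩, hyt ⟨hxB y hy.1, hy.2⟩, ht⟩
  refine hc.induction₂ (fun x y => ∃ t, IsPreconnected t ∧ t ⊆ U \ N ∧ B x \ N ⊆ t ∧ B y \ N ⊆ t)
    (fun x hx => ?_) ?_ (fun x y _ _ ⟨t, ht, htU, hxt, hyt⟩ => ⟨t, ht, htU, hyt, hxt⟩) hx.1 hy.1
  · filter_upwards [self_mem_nhdsWithin, nhdsWithin_le_nhds ((hBo x hx).mem_nhds (hxB x hx))]
      with y hy hyx
    obtain ⟨z, hz, hzN⟩ := hN.inter_open_nonempty _ ((hBo x hx).inter (hBo y hy))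
      ⟨y, hyx, hxB y hy⟩
    exact ⟨_, (hBN x hx).union z (mem_sdiff_of_mem hz.1 hzN) (mem_sdiff_of_mem hz.2 hzN) (hBN y hy),
      union_subset (sdiff_subset_sdiff_left (hBU x hx)) (sdiff_subset_sdiff_left (hBU y hy)),
      subset_union_left, subset_union_right⟩
  · rintro x y z - hyU - ⟨s, hs, hsU, hxs, hys⟩ ⟨t, ht, htU, hyt, hzt⟩
    obtain ⟨w, hw⟩ := hN.inter_open_nonempty _ (hBo y hyU) ⟨y, hxB y hyU⟩
    exact ⟨s ∪ t, hs.union w (hys hw) (hyt hw) ht, union_subset hsU htU,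
      hxs.trans subset_union_left, hzt.trans subset_union_right⟩

theorem dense_compl_iUnion_affineSubspace [FiniteDimensional ℝ E] [Finite ι]
    {L : ι → AffineSubspace ℝ E} (hL : ∀ i, L i ≠ ⊤) : Dense (⋃ i, (L i : Set E))ᶜ := by
  rw [compl_iUnion]
  refine dense_iInter_of_isOpen (fun i => (L i).closed_of_finiteDimensional.isOpen_compl)
    fun i => interior_eq_empty_iff_dense_compl.1 (not_nonempty_iff_eq_empty.1 fun h => hL i ?_)
  rw [eq_top_iff, ← isOpen_interior.affineSpan_eq_top h]
  exact affineSpan_le.2 interior_subset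

theorem notMem_affineSubspace_of_mem_segment {L : AffineSubspace ℝ E} {y w p : E} (hy : y ∉ L)
    (hw : w ∉ affineSpan ℝ (insert y (L : Set E))) (hp : p ∈ segment ℝ y w) : p ∉ L := by
  intro hpL
  rw [segment_eq_image_lineMap] at hp
  obtain ⟨t, -, rfl⟩ := hp
  have ht : t ≠ 0 := by
    rintro rfl
    exact hy (by simpa using hpL)
  refine hw ?_
  have h := AffineMap.lineMap_mem t⁻¹ (subset_affineSpan ℝ _ (mem_insert y (L : Set E)))
    (subset_affineSpan ℝ _ (mem_insert_of_mem y hpL))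
  simpa [AffineMap.lineMap_apply, ht] using h

theorem affineSpan_insert_ne_top [FiniteDimensional ℝ E] {L : AffineSubspace ℝ E}
    (hL : finrank ℝ L.direction + 1 < finrank ℝ E) (y : E) :
    affineSpan ℝ (insert y (L : Set E)) ≠ ⊤ := by
  intro h
  have hle := finrank_vectorSpan_insert_le L y
  rw [← direction_affineSpan, h, AffineSubspace.direction_top, finrank_top] at hle
  omega

theorem isPreconnected_diff_iUnion_affineSubspace [FiniteDimensional ℝ E] [Finite ι] {U : Set E}
    (hU : IsOpen U) (hc : IsPreconnected U) {L : ι → AffineSubspace ℝ E}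
    (hL : ∀ i, finrank ℝ (L i).direction + 1 < finrank ℝ E) :
    IsPreconnected (U \ ⋃ i, (L i : Set E)) := by
  have hspan (i : ι) (y : E) := affineSpan_insert_ne_top (hL i) y
  have hdense : Dense (⋃ i, (L i : Set E))ᶜ :=
    dense_compl_iUnion_affineSubspace fun i h => hspan i 0 (by simp [h])
  refine isPreconnected_diff_of_locally hc hdense fun x hx => ?_
  obtain ⟨r, hr, hball⟩ := Metric.isOpen_iff.1 hU x hx
  refine ⟨_, hball, Metric.isOpen_ball, Metric.mem_ball_self hr,
    isPreconnected_of_forall_pair fun y hy z hz => ?_⟩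
  -- a generic point `w` sees both `y` and `z` along segments avoiding all the subspaces
  obtain ⟨w, hwB, hw⟩ := (dense_compl_iUnion_affineSubspace
    (L := Sum.elim (fun i => affineSpan ℝ (insert y (L i : Set E)))
      (fun i => affineSpan ℝ (insert z (L i : Set E))))
    (Sum.rec (hspan · y) (hspan · z))).inter_open_nonempty _ Metric.isOpen_ball ⟨y, hy.1⟩
  simp only [mem_compl_iff, mem_iUnion, not_exists, Sum.forall, Sum.elim_inl, Sum.elim_inr,
    SetLike.mem_coe] at hw
  have havoid {q : E} (hq : q ∈ Metric.ball x r \ ⋃ i, (L i : Set E))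
      (hwq : ∀ i, w ∉ affineSpan ℝ (insert q (L i : Set E))) :
      segment ℝ q w ⊆ Metric.ball x r \ ⋃ i, (L i : Set E) := by
    intro p hp
    refine ⟨(convex_ball x r).segment_subset hq.1 hwB hp, ?_⟩
    simp only [mem_iUnion, not_exists]
    exact fun i => notMem_affineSubspace_of_mem_segment
      (fun hqL => hq.2 (mem_iUnion_of_mem i hqL)) (hwq i) hp
  exact ⟨segment ℝ y w ∪ segment ℝ z w, union_subset (havoid hy hw.1) (havoid hz hw.2),
    Or.inl (left_mem_segment ℝ y w), Or.inr (left_mem_segment ℝ z w),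
    (convex_segment y w).isPreconnected.union w (right_mem_segment ℝ y w)
      (right_mem_segment ℝ z w) (convex_segment z w).isPreconnected⟩

end Connectedness

section Moments

open Nat

theorem integral_pow_mul_sub_pow (p q : ℕ) {c : ℝ} (hc : 0 < c) :
    ∫ x in (0 : ℝ)..c, x ^ p * (c - x) ^ q = p ! * q ! / (p + q + 1)! * c ^ (p + q + 1) := by
  have hbeta : (p ! * q ! : ℂ) = (p + q + 1)! * Complex.betaIntegral (p + 1) (q + 1) := by
    have h := Complex.Gamma_mul_Gamma_eq_betaIntegral (s := p + 1) (t := q + 1)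
      (by simpa using p.cast_add_one_pos) (by simpa using q.cast_add_one_pos)
    rwa [show (p + 1 + (q + 1) : ℂ) = (p + q + 1 : ℕ) + 1 by push_cast; ring,
      Complex.Gamma_nat_eq_factorial, Complex.Gamma_nat_eq_factorial,
      Complex.Gamma_nat_eq_factorial] at h
  have hscaled := Complex.betaIntegral_scaled (p + 1) (q + 1) hc
  simp only [add_sub_cancel_right, Complex.cpow_natCast,
    show (p + 1 + (q + 1) - 1 : ℂ) = (p + q + 1 : ℕ) by push_cast; ring] at hscaled
  have hfac : ((p + q + 1)! : ℂ) ≠ 0 := mod_cast (p + q + 1).factorial_ne_zero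
  apply Complex.ofReal_injective
  rw [← intervalIntegral.integral_ofReal]
  push_cast
  rw [hscaled, hbeta]
  field_simp

/-- The open simplex of size `c` in the positive orthant of `ℝⁿ`, the domain of the coordinates of
a simplex with respect to the edges at one vertex. -/
def cornerSimplex (n : ℕ) (c : ℝ) : Set (Fin n → ℝ) := {s | (∀ i, 0 < s i) ∧ ∑ i, s i < c}

theorem isOpen_cornerSimplex (n : ℕ) (c : ℝ) : IsOpen (cornerSimplex n c) := by
  simp only [cornerSimplex, Set.ofPred_and, Set.ofPred_forall]
  exact (isOpen_iInter_of_finite fun i => isOpen_lt (by fun_prop) (by fun_prop)).inter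
    (isOpen_lt (by fun_prop) (by fun_prop))

theorem cornerSimplex_subset_Icc (n : ℕ) (c : ℝ) : cornerSimplex n c ⊆ Set.Icc 0 fun _ => c :=
  fun _ ⟨hpos, hsum⟩ => ⟨fun i => (hpos i).le, fun i =>
    (Finset.single_le_sum (fun j _ => (hpos j).le) (Finset.mem_univ i)).trans hsum.le⟩

theorem cons_mem_cornerSimplex {n : ℕ} {c x : ℝ} {t : Fin n → ℝ} :
    (Fin.cons x t : Fin (n + 1) → ℝ) ∈ cornerSimplex (n + 1) c ↔
      0 < x ∧ t ∈ cornerSimplex n (c - x) := by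
  simp only [cornerSimplex, Set.mem_ofPred_eq, Fin.forall_fin_succ, Fin.cons_zero, Fin.cons_succ,
    Fin.sum_univ_succ, lt_sub_iff_add_lt', and_assoc]

theorem pos_of_mem_cornerSimplex {n : ℕ} {c : ℝ} {s : Fin n → ℝ} (hs : s ∈ cornerSimplex n c) :
    0 < c :=
  (Finset.sum_nonneg fun i _ => (hs.1 i).le).trans_lt hs.2

theorem setIntegral_cornerSimplex_succ {n : ℕ} {c : ℝ} (hc : 0 ≤ c) {f : (Fin (n + 1) → ℝ) → ℝ}
    (hf : Continuous f) :
    ∫ s in cornerSimplex (n + 1) c, f s =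
      ∫ x in (0 : ℝ)..c, ∫ t in cornerSimplex n (c - x), f (Fin.cons x t) := by
  set A := cornerSimplex (n + 1) c
  have hA : MeasurableSet A := (isOpen_cornerSimplex _ _).measurableSet
  have hint : Integrable (A.indicator f) := (integrable_indicator_iff hA).2
    ((hf.continuousOn.integrableOn_compact isCompact_Icc).mono_set (cornerSimplex_subset_Icc _ _))
  have hcons (p : ℝ × (Fin n → ℝ)) :
      (MeasurableEquiv.piFinSuccAbove (fun _ : Fin (n + 1) => ℝ) 0).symm p = Fin.cons p.1 p.2 := by
    simp [MeasurableEquiv.piFinSuccAbove, Fin.consEquiv]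
  have hmp := (volume_preserving_piFinSuccAbove (fun _ : Fin (n + 1) => ℝ) 0).symm
  have hslice (x : ℝ) : ∫ t : Fin n → ℝ, A.indicator f (Fin.cons x t) =
      (Set.Ioc 0 c).indicator (fun x => ∫ t in cornerSimplex n (c - x), f (Fin.cons x t)) x := by
    by_cases hx : x ∈ Set.Ioc 0 c
    · rw [Set.indicator_of_mem hx, ← integral_indicator (isOpen_cornerSimplex _ _).measurableSet]
      refine integral_congr_ae (.of_forall fun t => Set.indicator_eq_indicator ?_ rfl)
      simp only [A, cons_mem_cornerSimplex, hx.1, true_and]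
    · rw [Set.indicator_of_notMem hx, integral_eq_zero_of_ae (.of_forall fun t => ?_)]
      refine Set.indicator_of_notMem (fun h => hx ?_) _
      rw [cons_mem_cornerSimplex] at h
      exact ⟨h.1, (sub_pos.1 (pos_of_mem_cornerSimplex h.2)).le⟩
  rw [← integral_indicator hA, ← hmp.integral_comp']
  simp_rw [hcons]
  rw [Measure.volume_eq_prod, integral_prod _ ((hmp.integrable_comp_of_integrable hint).congr
    (.of_forall fun p => congrArg (A.indicator f) (hcons p)))]
  simp_rw [hslice]
  rw [integral_indicator measurableSet_Ioc, intervalIntegral.integral_of_le hc]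

theorem setIntegral_cornerSimplex_monomial (n p : ℕ) (e : Fin n → ℕ) {c : ℝ} (hc : 0 < c) :
    ∫ s in cornerSimplex n c, (c - ∑ i, s i) ^ p * ∏ i, s i ^ e i =
      p ! * (∏ i, ((e i)! : ℝ)) / (p + ∑ i, e i + n)! * c ^ (p + ∑ i, e i + n) := by
  induction n generalizing c with
  | zero =>
    have huniv : cornerSimplex 0 c = Set.univ := Set.eq_univ_of_forall fun s => by
      simp [cornerSimplex, hc]
    have hp : (p ! : ℝ) ≠ 0 := mod_cast p.factorial_ne_zero
    simp [huniv, measureReal_def, volume_pi, hp]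
  | succ n ih =>
    set N := p + ∑ i : Fin n, e i.succ + n
    have hN : (N ! : ℝ) ≠ 0 := mod_cast N.factorial_ne_zero
    have hslice : ∀ x ∈ Set.Ioo 0 c, ∫ t in cornerSimplex n (c - x),
        (c - ∑ i, (Fin.cons x t : Fin (n + 1) → ℝ) i) ^ p *
          ∏ i, (Fin.cons x t : Fin (n + 1) → ℝ) i ^ e i =
        p ! * (∏ i : Fin n, ((e i.succ)! : ℝ)) / N ! * (x ^ e 0 * (c - x) ^ N) := by
      rintro x ⟨-, hx⟩
      simp only [Fin.prod_univ_succ, Fin.sum_univ_succ, Fin.cons_zero, Fin.cons_succ, ← sub_sub,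
        mul_left_comm _ (x ^ e 0)]
      rw [integral_const_mul, ih _ (sub_pos.2 hx), mul_left_comm]
    rw [setIntegral_cornerSimplex_succ hc.le (by fun_prop),
      intervalIntegral.integral_congr_Ioo_of_le hc.le hslice, intervalIntegral.integral_const_mul,
      integral_pow_mul_sub_pow _ _ hc, Fin.prod_univ_succ, Fin.sum_univ_succ,
      show p + (e 0 + ∑ i : Fin n, e i.succ) + (n + 1) = e 0 + N + 1 by omega]
    field_simp

theorem affineMap_add_apply {k V W : Type*} [Ring k] [AddCommGroup V] [AddCommGroup W] [Module k V]
    [Module k W] (f : V →ᵃ[k] W) (x w : V) : f (x + w) = f x + f.linear w := by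
  rw [add_comm, ← vadd_eq_add, f.map_vadd, vadd_eq_add, add_comm]

variable {E : Type*} [NormedAddCommGroup E] [NormedSpace ℝ E] {n : ℕ}
  (b : AffineBasis (Fin (n + 1)) ℝ E)

/-- The linear part of the parametrization `s ↦ b 0 + ∑ k, s k • (b (k + 1) - b 0)` of space by the
coordinates with respect to the edges of a simplex at its first vertex. -/
noncomputable def edgeEquiv : (Fin n → ℝ) ≃L[ℝ] E :=
  ((b.basisOf 0).reindex (finSuccAboveEquiv 0).symm).equivFunL.symm

theorem coord_succ_edgeEquiv (s : Fin n → ℝ) (k : Fin n) :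
    b.coord k.succ (b 0 + edgeEquiv b s) = s k := by
  have h : edgeEquiv b s = ∑ k, s k • (b k.succ - b 0) :=
    (Module.Basis.equivFun_symm_apply _ s).trans (by simp [finSuccAboveEquiv_apply])
  have hlin (i : Fin n) : (b.coord k.succ).linear (b i.succ - b 0) = if k = i then 1 else 0 := by
    rw [← vsub_eq_sub, AffineMap.linearMap_vsub]
    simp [AffineBasis.coord_apply, (Fin.succ_ne_zero k)]
  rw [affineMap_add_apply, h, map_sum]
  simp only [map_smul, hlin, b.coord_apply_ne (Fin.succ_ne_zero k), smul_eq_mul, mul_ite, mul_one,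
    mul_zero, Finset.sum_ite_eq, Finset.mem_univ, if_true, zero_add]

theorem coord_zero_edgeEquiv (s : Fin n → ℝ) :
    b.coord 0 (b 0 + edgeEquiv b s) = 1 - ∑ k, s k := by
  have h := b.sum_coord_apply_eq_one (b 0 + edgeEquiv b s)
  rw [Fin.sum_univ_succ] at h
  simp only [coord_succ_edgeEquiv] at h
  linarith

theorem preimage_edgeEquiv_interior_convexHull :
    (fun s => b 0 + edgeEquiv b s) ⁻¹' interior (convexHull ℝ (Set.range b)) =
      cornerSimplex n 1 := by
  ext s
  simp only [b.interior_convexHull, Set.mem_preimage, Set.mem_ofPred_eq, cornerSimplex,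
    Fin.forall_fin_succ (n := n), coord_zero_edgeEquiv, coord_succ_edgeEquiv, sub_pos, and_comm]

variable [MeasurableSpace E] [BorelSpace E] (μ : Measure E) [μ.IsAddHaarMeasure]

theorem exists_setIntegral_interior_convexHull_eq : ∃ c : ℝ, ∀ g : E → ℝ,
    ∫ x in interior (convexHull ℝ (Set.range b)), g x ∂μ =
      c * ∫ s in cornerSimplex n 1, g (b 0 + edgeEquiv b s) := by
  have := b.finiteDimensional
  have : (Measure.map (edgeEquiv b) volume).IsAddHaarMeasure :=
    (edgeEquiv b).isAddHaarMeasure_map volume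
  have hemb : MeasurableEmbedding fun s => b 0 + edgeEquiv b s :=
    ((edgeEquiv b).toHomeomorph.trans (Homeomorph.addLeft (b 0))).measurableEmbedding
  have hmap : Measure.map (fun s => b 0 + edgeEquiv b s) volume =
      Measure.map (edgeEquiv b) volume := by
    rw [← map_add_left_eq_self (Measure.map (edgeEquiv b) volume) (b 0),
      Measure.map_map (by fun_prop) (edgeEquiv b).continuous.measurable]
    rfl
  have hμ := Measure.isAddLeftInvariant_eq_smul μ (Measure.map (edgeEquiv b) volume)
  set c := μ.addHaarScalarFactor (Measure.map (edgeEquiv b) volume)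
  refine ⟨c, fun g => ?_⟩
  rw [hμ, Measure.restrict_smul, integral_smul_nnreal_measure, ← hmap, hemb.setIntegral_map,
    preimage_edgeEquiv_interior_convexHull]
  rfl

theorem setIntegral_prod_coord_pow (e : Fin (n + 1) → ℕ) :
    ∫ x in interior (convexHull ℝ (Set.range b)), ∏ i, b.coord i x ^ e i ∂μ =
      n ! * (∏ i, ((e i)! : ℝ)) / (∑ i, e i + n)! *
        μ.real (interior (convexHull ℝ (Set.range b))) := by
  obtain ⟨c, hc⟩ := exists_setIntegral_interior_convexHull_eq b μ
  have hmoment (e : Fin (n + 1) → ℕ) :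
      ∫ x in interior (convexHull ℝ (Set.range b)), ∏ i, b.coord i x ^ e i ∂μ =
        c * ((∏ i, ((e i)! : ℝ)) / (∑ i, e i + n)!) := by
    simp only [hc, Fin.prod_univ_succ, coord_zero_edgeEquiv, coord_succ_edgeEquiv,
      setIntegral_cornerSimplex_monomial _ _ _ one_pos, Fin.sum_univ_succ, one_pow, mul_one]
  have hvol : μ.real (interior (convexHull ℝ (Set.range b))) = c / n ! := by
    simpa [div_eq_mul_inv] using hmoment 0
  have hn : (n ! : ℝ) ≠ 0 := mod_cast n.factorial_ne_zero
  rw [hmoment, hvol]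
  field_simp

end Moments

section Barycentric

open Finset

variable {ι k V : Type*} [Field k] [AddCommGroup V] [Module k V]

theorem coord_linear_sub [DecidableEq ι] (b : AffineBasis ι k V) (i l m : ι) :
    (b.coord i).linear (b l - b m) = (if i = l then 1 else 0) - if i = m then 1 else 0 := by
  rw [← vsub_eq_sub, AffineMap.linearMap_vsub, b.coord_apply, b.coord_apply, vsub_eq_sub]

theorem affineMap_eq_sum_coord_mul [Fintype ι] (b : AffineBasis ι k V) (f : V →ᵃ[k] k) (x : V) :
    f x = ∑ i, b.coord i x * f (b i) := by
  have hsum := b.sum_coord_apply_eq_one x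
  have h := univ.map_affineCombination b (fun i => b.coord i x) hsum f
  rw [b.affineCombination_coord_eq_self, affineCombination_eq_linear_combination _ _ _ hsum] at h
  exact h

theorem sum_coord_linear [Fintype ι] (b : AffineBasis ι k V) (w : V) :
    ∑ i, (b.coord i).linear w = 0 := by
  have h := b.sum_coord_apply_eq_one (0 + w)
  simp only [affineMap_add_apply, sum_add_distrib, b.sum_coord_apply_eq_one] at h
  simpa using h

variable [Finite ι] {b b' : AffineBasis ι k V} {j : ι}

theorem coord_apply_of_agree_off [DecidableEq ι] (hface : ∀ i, i ≠ j → b i = b' i) (i : ι)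
    (x : V) :
    b.coord i x = (if i = j then 0 else b'.coord i x) + b'.coord j x * b.coord i (b' j) := by
  cases nonempty_fintype ι
  rw [affineMap_eq_sum_coord_mul b', ← sum_erase_add _ _ (mem_univ j),
    sum_congr rfl fun l hl => by rw [← hface l (ne_of_mem_erase hl), b.coord_apply]]
  simp only [mul_ite, mul_one, mul_zero, sum_ite_eq, mem_erase, mem_univ, and_true, ite_not]

theorem coord_apex_apply (hface : ∀ i, i ≠ j → b i = b' i) (x : V) :
    b.coord j x = b.coord j (b' j) * b'.coord j x := by
  classical
  rw [coord_apply_of_agree_off hface j x, if_pos rfl, zero_add, mul_comm]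

theorem coord_apex_mul_coord_apex (hface : ∀ i, i ≠ j → b i = b' i) :
    b.coord j (b' j) * b'.coord j (b j) = 1 := by
  rw [← coord_apex_apply hface, b.coord_apply_eq]

theorem coord_linear_apex_apply (hface : ∀ i, i ≠ j → b i = b' i) (w : V) :
    (b.coord j).linear w = b.coord j (b' j) * (b'.coord j).linear w := by
  have h := coord_apex_apply hface (0 + w)
  rw [affineMap_add_apply, affineMap_add_apply, coord_apex_apply hface 0] at h
  linear_combination h

end Barycentric

section Simplex

open Finset Nat Topology

variable {ι E : Type*} [NormedAddCommGroup E] [NormedSpace ℝ E]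
  {b b' : AffineBasis ι ℝ E} {j : ι}

theorem coord_centroid_erase_eq_zero [Fintype ι] [DecidableEq ι] [Nontrivial ι]
    (b : AffineBasis ι ℝ E) (j : ι) : b.coord j ((univ.erase j).centroid ℝ b) = 0 := by
  obtain ⟨i, hi⟩ := exists_ne j
  exact b.coord_apply_combination_of_notMem (notMem_erase _ _)
    ((univ.erase j).sum_centroidWeights_eq_one_of_nonempty ℝ ⟨i, mem_erase.2 ⟨hi, mem_univ i⟩⟩)

theorem coord_centroid_erase_pos [Fintype ι] [DecidableEq ι] (b : AffineBasis ι ℝ E) {i : ι}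
    (hi : i ≠ j) :
    0 < b.coord i ((univ.erase j).centroid ℝ b) := by
  have hmem := mem_erase.2 ⟨hi, mem_univ i⟩
  rw [b.coord_apply_centroid hmem, inv_pos, Nat.cast_pos, card_pos]
  exact ⟨i, hmem⟩

theorem exists_mem_convexHull_inter_coord_pos [Finite ι] [Nontrivial ι]
    (hface : ∀ i, i ≠ j → b i = b' i) (hpos : 0 < b.coord j (b' j)) :
    ∃ x ∈ convexHull ℝ (Set.range b) ∩ convexHull ℝ (Set.range b'), 0 < b.coord j x := by
  classical
  cases nonempty_fintype ι
  let y : E := (univ.erase j).centroid ℝ b'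
  have hyj : b'.coord j y = 0 := coord_centroid_erase_eq_zero b' j
  have hyi {i : ι} (hi : i ≠ j) : 0 < b'.coord i y := coord_centroid_erase_pos b' hi
  have hline (a : AffineBasis ι ℝ E) (i : ι) (t : ℝ) :
      a.coord i (AffineMap.lineMap y (b' j) t) = (1 - t) * a.coord i y + t * a.coord i (b' j) := by
    rw [AffineMap.apply_lineMap, AffineMap.lineMap_apply_ring]
  -- entering the second simplex from the face, one stays in the first one for a while
  have hcont (i : ι) : ∀ᶠ t : ℝ in 𝓝[>] 0,
      i ≠ j → 0 < b.coord i (AffineMap.lineMap y (b' j) t) := by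
    refine nhdsWithin_le_nhds (Filter.eventually_imp_distrib_left.2 fun hi => ?_)
    simp only [hline]
    refine ContinuousAt.eventually_lt (by fun_prop) (by fun_prop) ?_
    rw [coord_apply_of_agree_off hface i y, if_neg hi, hyj]
    simpa using hyi hi
  obtain ⟨t, ⟨ht0, ht1⟩, ht⟩ :=
    ((Filter.eventually_of_mem (Ioo_mem_nhdsGT one_pos) fun _ h => h).and
      (Filter.eventually_all.2 hcont)).exists
  have hbj : 0 < b.coord j (AffineMap.lineMap y (b' j) t) := by
    rw [hline, coord_apex_apply hface y, hyj]
    simpa using mul_pos ht0 hpos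
  refine ⟨_, ⟨?_, ?_⟩, hbj⟩
  · rw [b.convexHull_eq_nonneg_coord]
    intro i
    obtain rfl | hi := eq_or_ne i j
    exacts [hbj.le, (ht i hi).le]
  · rw [b'.convexHull_eq_nonneg_coord]
    intro i
    rw [hline, b'.coord_apply]
    obtain rfl | hi := eq_or_ne i j
    · simpa [hyj] using ht0.le
    · simpa [hi] using mul_nonneg (sub_nonneg.2 ht1.le) (hyi hi).le

theorem coord_apex_neg [Finite ι] [Nontrivial ι] (hface : ∀ i, i ≠ j → b i = b' i)
    (hinter : ∀ x ∈ convexHull ℝ (Set.range b) ∩ convexHull ℝ (Set.range b'), b.coord j x = 0) :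
    b.coord j (b' j) < 0 := by
  by_contra! hnonneg
  obtain ⟨x, hx, hpos⟩ := exists_mem_convexHull_inter_coord_pos hface
    (hnonneg.lt_of_ne' (left_ne_zero_of_mul_eq_one (coord_apex_mul_coord_apex hface)))
  exact hpos.ne' (hinter x hx)

theorem hasFDerivAt_affineMap [FiniteDimensional ℝ E] (f : E →ᵃ[ℝ] ℝ) (x : E) :
    HasFDerivAt f f.linear.toContinuousLinearMap x := by
  rw [f.decomp]
  exact f.linear.toContinuousLinearMap.hasFDerivAt.add_const _

theorem contDiff_affineMap [FiniteDimensional ℝ E] {n : WithTop ℕ∞} (f : E →ᵃ[ℝ] ℝ) :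
    ContDiff ℝ n f := by
  rw [f.decomp]
  exact f.linear.toContinuousLinearMap.contDiff.add contDiff_const

theorem measureReal_interior_convexHull_of_agree_off [Finite ι] [MeasurableSpace E] [BorelSpace E]
    (μ : Measure E) [μ.IsAddHaarMeasure] (hface : ∀ i, i ≠ j → b i = b' i) :
    μ.real (interior (convexHull ℝ (Set.range b'))) =
      |b.coord j (b' j)| * μ.real (interior (convexHull ℝ (Set.range b))) := by
  classical
  have := b.finiteDimensional
  -- the affine map `x ↦ x + λ_j(x) (b' j - b j)` carries `b` to `b'`
  set v := b' j - b j with hv_def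
  let f := LinearMap.transvection (b.coord j).linear v
  have hdet : LinearMap.det f = b.coord j (b' j) := by
    rw [LinearMap.transvection.det, hv_def, ← vsub_eq_sub, AffineMap.linearMap_vsub,
      b.coord_apply_eq, vsub_eq_sub, add_sub_cancel]
  have hdet_ne : LinearMap.det f ≠ 0 :=
    hdet ▸ left_ne_zero_of_mul_eq_one (coord_apex_mul_coord_apex hface)
  have hcoord (i : ι) (x : E) : b'.coord i (b.coord j 0 • v + f x) = b.coord i x := by
    have hv : (b'.coord i).linear v = (if i = j then 1 else 0) - b'.coord i (b j) := by
      rw [hv_def, ← vsub_eq_sub, AffineMap.linearMap_vsub, b'.coord_apply, vsub_eq_sub]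
    have hx : b.coord j x = b.coord j 0 + (b.coord j).linear x := by
      rw [← affineMap_add_apply, zero_add]
    have hf : b.coord j 0 • v + f x = x + b.coord j x • v := by
      rw [LinearMap.transvection.apply, hx, add_smul]
      abel
    rw [hf, affineMap_add_apply, map_smul, hv, smul_eq_mul,
      coord_apply_of_agree_off (fun i hi => (hface i hi).symm) i x]
    obtain rfl | hi := eq_or_ne i j
    · rw [if_pos rfl, if_pos rfl]
      ring
    · rw [if_neg hi, if_neg hi]
      ring
  have hpre : f ⁻¹' ((fun x => b.coord j 0 • v + x) ⁻¹' interior (convexHull ℝ (Set.range b'))) =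
      interior (convexHull ℝ (Set.range b)) := by
    ext x
    simp only [b.interior_convexHull, b'.interior_convexHull, Set.mem_preimage, Set.mem_ofPred_eq,
      hcoord]
  rw [← hpre, measureReal_def μ (f ⁻¹' _), Measure.addHaar_preimage_linearMap μ hdet_ne,
    measure_preimage_add, ENNReal.toReal_mul, ENNReal.toReal_ofReal (abs_nonneg _), ← hdet,
    abs_inv, mul_inv_cancel_left₀ (abs_ne_zero.2 hdet_ne), measureReal_def]

/-- The product of the barycentric coordinates of the vertices other than `j`. On the simplex it
vanishes on all facets except the one opposite to the vertex `j`. -/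
noncomputable def faceBubble [Fintype ι] [DecidableEq ι] (b : AffineBasis ι ℝ E) (j : ι) (x : E) :
    ℝ :=
  ∏ i ∈ univ.erase j, b.coord i x

theorem contDiff_faceBubble [Fintype ι] [DecidableEq ι] {n : WithTop ℕ∞} :
    ContDiff ℝ n (faceBubble b j) :=
  have := b.finiteDimensional
  contDiff_prod fun i _ => contDiff_affineMap (b.coord i)

theorem fderiv_faceBubble [Fintype ι] [DecidableEq ι] (x w : E) :
    fderiv ℝ (faceBubble b j) x w =
      ∑ i ∈ univ.erase j, (∏ l ∈ (univ.erase j).erase i, b.coord l x) * (b.coord i).linear w := by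
  have := b.finiteDimensional
  have h : HasFDerivAt (faceBubble b j) _ x :=
    HasFDerivAt.finsetProd fun i _ => hasFDerivAt_affineMap (b.coord i) x
  rw [h.fderiv]
  simp

theorem setIntegral_fderiv_faceBubble [MeasurableSpace E] [BorelSpace E] (μ : Measure E)
    [μ.IsAddHaarMeasure] {n : ℕ} (b : AffineBasis (Fin (n + 1)) ℝ E) (j : Fin (n + 1)) (w : E) :
    ∫ x in interior (convexHull ℝ (Set.range b)), fderiv ℝ (faceBubble b j) x w ∂μ =
      -(n ! / (2 * n - 1)! * μ.real (interior (convexHull ℝ (Set.range b))) *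
        (b.coord j).linear w) := by
  have := b.finiteDimensional
  have hmoment : ∀ i ∈ univ.erase j, ∫ x in interior (convexHull ℝ (Set.range b)),
      ∏ l ∈ (univ.erase j).erase i, b.coord l x ∂μ =
        n ! / (2 * n - 1)! * μ.real (interior (convexHull ℝ (Set.range b))) := by
    intro i hi
    have hcard : ((univ.erase j).erase i).card + n = 2 * n - 1 := by
      rw [card_erase_of_mem hi, card_erase_of_mem (mem_univ j), Finset.card_univ, Fintype.card_fin]
      have : j ≠ i := (ne_of_mem_erase hi).symm
      have : 0 < n := by omega
      omega
    have h := setIntegral_prod_coord_pow b μ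
      fun l => if l ∈ (univ.erase j).erase i then 1 else 0
    have hfac (l : Fin (n + 1)) (s : Finset (Fin (n + 1))) : (if l ∈ s then 1 else 0)! = 1 := by
      split_ifs <;> rfl
    simpa only [pow_ite, pow_one, pow_zero, prod_ite_mem, univ_inter, sum_boole, filter_univ_mem,
      Nat.cast_id, hcard, hfac, Nat.cast_one, prod_const_one, mul_one] using h
  have hsum : ∑ i ∈ univ.erase j, (b.coord i).linear w = -(b.coord j).linear w := by
    rw [eq_neg_iff_add_eq_zero, sum_erase_add _ _ (mem_univ j), sum_coord_linear]
  simp only [fderiv_faceBubble]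
  rw [integral_finsetSum _ fun i _ => ?_]
  · rw [sum_congr rfl fun i hi => by rw [integral_mul_const, hmoment i hi], ← mul_sum, hsum,
      mul_neg]
  · refine ((Continuous.continuousOn ?_).integrableOn_compact
      ((Set.finite_range b).isCompact_convexHull ℝ)).mono_set interior_subset
    exact (continuous_finsetProd _ fun l _ => (contDiff_affineMap (n := 0) _).continuous).mul
      continuous_const

end Simplex

section Polynomials

open Finset

variable {σ ι : Type*}

theorem fwdDiff_iter_eval_eq_zero {n : ℕ} {q : MvPolynomial σ ℝ} (hq : q.totalDegree < n)
    (x w : σ → ℝ) : (fwdDiff w)^[n] (fun y => MvPolynomial.eval y q) x = 0 := by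
  set P : Polynomial ℝ := MvPolynomial.aeval
    (fun k => Polynomial.C (x k) + Polynomial.X * Polynomial.C (w k)) q with hP
  have hdeg : P.natDegree < n := by
    refine (MvPolynomial.aeval_natDegree_le q le_rfl _ (n := 1) fun k => ?_).trans_lt
      (by rwa [mul_one])
    compute_degree
  have heval (t : ℝ) : MvPolynomial.eval (x + t • w) q = P.eval t := by
    rw [hP, ← Polynomial.coe_aeval_eq_eval, MvPolynomial.comp_aeval_apply,
      ← MvPolynomial.aeval_eq_eval]
    congr 2
    ext k
    rw [Polynomial.coe_aeval_eq_eval, Polynomial.eval_add, Polynomial.eval_mul, Polynomial.eval_C,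
      Polynomial.eval_C, Polynomial.eval_X, Pi.add_apply, Pi.smul_apply, smul_eq_mul]
  have h := congrFun (Polynomial.fwdDiff_iter_eq_zero_of_degree_lt hdeg) 0
  rw [fwdDiff_iter_eq_sum_shift] at h ⊢
  simp only [← Nat.cast_smul_eq_nsmul ℝ _ w, heval]
  simpa only [nsmul_one, zero_add, Pi.zero_apply] using h

variable [Fintype σ]

theorem linearMap_eq_sum_mul_single [DecidableEq σ] {W : Type*} [AddCommGroup W] [Module ℝ W]
    (f : EuclideanSpace ℝ σ →ₗ[ℝ] W) (x : EuclideanSpace ℝ σ) :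
    f x = ∑ k, x k • f (EuclideanSpace.single k 1) := by
  conv_lhs => rw [← (EuclideanSpace.basisFun σ ℝ).sum_repr x]
  simp

theorem exists_mvPolynomial_eq_affineMap (f : EuclideanSpace ℝ σ →ᵃ[ℝ] ℝ) :
    ∃ q : MvPolynomial σ ℝ, q.totalDegree ≤ 1 ∧ ∀ x, f x = MvPolynomial.eval x.ofLp q := by
  classical
  refine ⟨MvPolynomial.C (f 0) + ∑ k,
    MvPolynomial.C (f.linear (EuclideanSpace.single k 1)) * MvPolynomial.X k, ?_, fun x => ?_⟩
  · refine (MvPolynomial.totalDegree_add _ _).trans (max_le (by simp) ?_)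
    refine MvPolynomial.totalDegree_finsetSum_le fun k _ => ?_
    refine (MvPolynomial.totalDegree_mul _ _).trans ?_
    rw [MvPolynomial.totalDegree_C, MvPolynomial.totalDegree_X]
  · conv_lhs => rw [← zero_add x, affineMap_add_apply, linearMap_eq_sum_mul_single]
    simp [mul_comm]

variable [Fintype ι]

theorem exists_mvPolynomial_eq_faceBubble [DecidableEq ι]
    (b : AffineBasis ι ℝ (EuclideanSpace ℝ σ)) (j : ι) :
    ∃ q ∈ MvPolynomial.restrictTotalDegree σ ℝ (Fintype.card ι - 1),
      ∀ x, faceBubble b j x = MvPolynomial.eval x.ofLp q := by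
  choose q hdeg hq using fun i => exists_mvPolynomial_eq_affineMap (b.coord i)
  refine ⟨∏ i ∈ univ.erase j, q i, (MvPolynomial.mem_restrictTotalDegree _ _ _).2 ?_, fun x => ?_⟩
  · calc _ ≤ ∑ i ∈ univ.erase j, (q i).totalDegree := MvPolynomial.totalDegree_finsetProd _ _
      _ ≤ ∑ _i ∈ univ.erase j, 1 := sum_le_sum fun i _ => hdeg i
      _ = Fintype.card ι - 1 := by
        rw [← card_eq_sum_ones, card_erase_of_mem (mem_univ j), card_univ]
  · rw [faceBubble, map_prod]
    exact prod_congr rfl fun i _ => hq i x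

theorem exists_quadraticForm_coord (b : AffineBasis ι ℝ (EuclideanSpace ℝ σ))
    {q : MvPolynomial σ ℝ} (hq : q ∈ MvPolynomial.restrictTotalDegree σ ℝ 2) :
    ∃ C : ι → ι → ℝ, ∀ x, MvPolynomial.eval x.ofLp q =
      ∑ k, ∑ l, C k l * (b.coord k x * b.coord l x) := by
  have hmul (f g : EuclideanSpace ℝ σ →ᵃ[ℝ] ℝ) : ∃ C : ι → ι → ℝ, ∀ x, f x * g x =
      ∑ k, ∑ l, C k l * (b.coord k x * b.coord l x) := by
    refine ⟨fun k l => f (b k) * g (b l), fun x => ?_⟩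
    rw [affineMap_eq_sum_coord_mul b f, affineMap_eq_sum_coord_mul b g, sum_mul_sum]
    exact sum_congr rfl fun k _ => sum_congr rfl fun l _ => by ring
  let X (i : σ) : EuclideanSpace ℝ σ →ᵃ[ℝ] ℝ := (EuclideanSpace.projₗ i).toAffineMap
  rw [MvPolynomial.restrictTotalDegree, MvPolynomial.restrictSupport_eq_span] at hq
  induction hq using Submodule.span_induction with
  | mem _ h =>
    obtain ⟨s, hs, rfl⟩ := h
    have heval (x : EuclideanSpace ℝ σ) : MvPolynomial.eval x.ofLp (MvPolynomial.monomial s 1) =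
        (s.toMultiset.map x.ofLp).prod := by
      rw [MvPolynomial.eval_monomial, one_mul, Finsupp.toMultiset_map, Finsupp.prod_toMultiset,
        Finsupp.prod_mapDomain_index (fun _ => pow_zero _) fun _ _ _ => pow_add _ _ _]
    have hcard : s.toMultiset.card ≤ 2 := s.card_toMultiset.trans_le hs
    simp only [heval]
    generalize s.toMultiset = m at hcard ⊢
    interval_cases hm : m.card
    · obtain rfl := Multiset.card_eq_zero.1 hm
      simpa using hmul (AffineMap.const ℝ _ 1) (AffineMap.const ℝ _ 1)
    · obtain ⟨i, rfl⟩ := Multiset.card_eq_one.1 hm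
      simpa [X] using hmul (X i) (AffineMap.const ℝ _ 1)
    · obtain ⟨i, j, rfl⟩ := Multiset.card_eq_two.1 hm
      simpa [X] using hmul (X i) (X j)
  | zero => exact ⟨0, by simp⟩
  | add p q _ _ hp hq =>
    obtain ⟨C, hC⟩ := hp
    obtain ⟨D, hD⟩ := hq
    exact ⟨C + D, fun x => by simp [hC, hD, add_mul, sum_add_distrib]⟩
  | smul c p _ hp =>
    obtain ⟨C, hC⟩ := hp
    exact ⟨c • C, fun x => by simp [hC, mul_assoc, mul_sum]⟩

end Polynomials

section ReferenceBubble

open Finset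

theorem deriv_quartic {f : ℝ → ℝ} {c₀ c₁ c₂ c₃ c₄ : ℝ}
    (hf : ∀ x, f x = c₀ + c₁ * x + c₂ * x ^ 2 + c₃ * x ^ 3 + c₄ * x ^ 4) (x : ℝ) :
    deriv f x = c₁ + 2 * c₂ * x + 3 * c₃ * x ^ 2 + 4 * c₄ * x ^ 3 := by
  rw [funext hf]
  refine ((((((hasDerivAt_id' x).const_mul c₁).const_add c₀).fun_add
    ((hasDerivAt_pow 2 x).const_mul c₂)).fun_add ((hasDerivAt_pow 3 x).const_mul c₃)).fun_add
    ((hasDerivAt_pow 4 x).const_mul c₄)).deriv.trans ?_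
  norm_num
  ring

theorem sum_deriv_refBubble (s : Fin 3 → ℝ) :
    ∑ k, deriv (fun t => refBubble (Function.update s k t) k) (s k) =
      4 * s 0 * (s 0 - s 1 - s 2) := by
  have h1 (x y z : ℝ) := deriv_quartic (f := fun t => refBubble1 t y z)
    (c₄ := 263 / 12) (c₃ := 38 * y + 265 / 3 * z - 253 / 6)
    (c₂ := 29 * y ^ 2 + 96 * y * z + 209 / 2 * z ^ 2 - 87 / 2 * y - 119 * z + 703 / 28)
    (c₁ := -16 * y ^ 3 + 42 * y ^ 2 * z + 42 * y * z ^ 2 + 103 / 3 * z ^ 3 + 21 / 2 * y ^ 2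
      - 56 * y * z - 65 * z ^ 2 + 7 / 2 * y + 251 / 7 * z - 181 / 42)
    (c₀ := refBubble1 0 y z) (fun t => by unfold refBubble1; ring) x
  have h2 (x y z : ℝ) := deriv_quartic (f := fun t => refBubble2 x t z)
    (c₄ := 0) (c₃ := -(203 / 3) * x - 64 / 3 * z + 79 / 8)
    (c₂ := -(233 / 2) * x ^ 2 - 225 * x * z - 21 * z ^ 2 + 1025 / 8 * x + 417 / 8 * z - 447 / 28)
    (c₁ := -(233 / 3) * x ^ 3 - 235 * x ^ 2 * z - 209 * x * z ^ 2 - 16 / 3 * z ^ 3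
      + 1105 / 8 * x ^ 2 + 1077 / 4 * x * z + 289 / 8 * z ^ 2 - 505 / 7 * x - 251 / 7 * z
      + 625 / 84)
    (c₀ := refBubble2 x 0 z) (fun t => by unfold refBubble2; ring) y
  have h3 (x y z : ℝ) := deriv_quartic (f := fun t => refBubble3 x y t)
    (c₄ := -(29 / 4)) (c₃ := 77 / 8)
    (c₂ := -15 * x ^ 2 + 129 * x * y + 11 * y ^ 2 - 141 / 8 * x - 193 / 8 * y)
    (c₁ := -10 * x ^ 3 + 119 * x ^ 2 * y + 145 * x * y ^ 2 + 16 * y ^ 3 - 61 / 8 * x ^ 2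
      - 693 / 4 * x * y - 321 / 8 * y ^ 2 + 307 / 14 * x + 199 / 7 * y - 263 / 84)
    (c₀ := refBubble3 x y 0) (fun t => by unfold refBubble3; ring) z
  simp only [Fin.sum_univ_three, refBubble, Matrix.cons_val, Function.update_self,
    Function.update_of_ne, ne_eq, Fin.reduceEq, not_false_eq_true, h1, h2, h3]
  ring

theorem contDiff_refBubble {n : WithTop ℕ∞} : ContDiff ℝ n refBubble := by
  refine contDiff_pi.2 fun k => ?_
  fin_cases k <;> simp only [refBubble, Fin.isValue, Fin.zero_eta, Fin.mk_one, Fin.reduceFinMk,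
    Matrix.cons_val]
  · unfold refBubble1
    fun_prop
  · unfold refBubble2
    fun_prop
  · unfold refBubble3
    fun_prop

/-- The homogeneous part of degree four of `refBubble`. -/
noncomputable def leadingForm (s : Fin 3 → ℝ) : Fin 3 → ℝ :=
  let x := s 0
  let y := s 1
  let z := s 2
  ![263 / 12 * x ^ 4 + 38 * x ^ 3 * y + 265 / 3 * x ^ 3 * z + 29 * x ^ 2 * y ^ 2
      + 96 * x ^ 2 * y * z + 209 / 2 * x ^ 2 * z ^ 2 - 16 * x * y ^ 3 + 42 * x * y ^ 2 * z
      + 42 * x * y * z ^ 2 + 103 / 3 * x * z ^ 3 + 7 / 6 * y ^ 4 - y ^ 2 * z ^ 2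
      - 335 / 12 * z ^ 4,
    -(233 / 3) * x ^ 3 * y + 67 / 9 * x ^ 3 * z - 233 / 2 * x ^ 2 * y ^ 2 - 235 * x ^ 2 * y * z
      + 163 / 6 * x ^ 2 * z ^ 2 - 203 / 3 * x * y ^ 3 - 225 * x * y ^ 2 * z - 209 * x * y * z ^ 2
      + 301 / 9 * x * z ^ 3 - 64 / 3 * y ^ 3 * z - 21 * y ^ 2 * z ^ 2 - 16 / 3 * y * z ^ 3,
    -10 * x ^ 3 * y - 10 * x ^ 3 * z + x ^ 2 * y ^ 2 + 119 * x ^ 2 * y * z - 15 * x ^ 2 * z ^ 2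
      + 16 * x * y ^ 3 + 145 * x * y ^ 2 * z + 129 * x * y * z ^ 2 + 16 * y ^ 3 * z
      + 11 * y ^ 2 * z ^ 2 - 29 / 4 * z ^ 4]

theorem fwdDiff_iter_refBubble (e s : Fin 3 → ℝ) :
    (fwdDiff e)^[4] refBubble s = (24 : ℝ) • leadingForm e := by
  rw [fwdDiff_iter_eq_sum_shift]
  ext k
  fin_cases k <;>
    simp [sum_range_succ, Nat.choose, refBubble, refBubble1, refBubble2, refBubble3, leadingForm]
      <;> ring

theorem leadingForm_smul (c : ℝ) (s : Fin 3 → ℝ) : leadingForm (c • s) = c ^ 4 • leadingForm s := by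
  ext k
  fin_cases k <;> simp [leadingForm] <;> ring

end ReferenceBubble

section PointwiseForms

variable {u u' v g h : E3 → E3} {x : E3}

theorem divAt_add (hu : DifferentiableAt ℝ u x) (hv : DifferentiableAt ℝ v x) :
    divAt (u + v) x = divAt u x + divAt v x := by
  simp only [divAt, fderiv_add hu hv, add_apply, PiLp.add_apply, Finset.sum_add_distrib]

theorem divAt_smul (c : ℝ) : divAt (c • v) x = c * divAt v x := by
  simp only [divAt, fderiv_const_smul_field, Pi.smul_apply, smul_apply, PiLp.smul_apply,
    smul_eq_mul, Finset.mul_sum]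

theorem divAt_sum_smul {ι : Type*} {s : Finset ι} {φ : ι → E3 → ℝ} {w : ι → E3}
    (hφ : ∀ k ∈ s, DifferentiableAt ℝ (φ k) x) :
    divAt (fun y => ∑ k ∈ s, φ k y • w k) x = ∑ k ∈ s, fderiv ℝ (φ k) x (w k) := by
  have h : HasFDerivAt (fun y => ∑ k ∈ s, φ k y • w k)
      (∑ k ∈ s, (fderiv ℝ (φ k) x).smulRight (w k)) x :=
    HasFDerivAt.fun_sum fun k hk => (hφ k hk).hasFDerivAt.smul_const (w k)
  rw [divAt, h.fderiv]
  simp only [_root_.sum_apply, ContinuousLinearMap.smulRight_apply, WithLp.ofLp_sum,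
    WithLp.ofLp_smul, Finset.sum_apply, Pi.smul_apply, smul_eq_mul]
  rw [Finset.sum_comm]
  refine Finset.sum_congr rfl fun k _ => ?_
  simpa [mul_comm] using (linearMap_eq_sum_mul_single (fderiv ℝ (φ k) x).toLinearMap (w k)).symm

theorem gradInnerAt_comm : gradInnerAt u v = gradInnerAt v u := by
  funext x
  simp only [gradInnerAt, mul_comm]

theorem gradInnerAt_add_left (hu : DifferentiableAt ℝ u x) (hu' : DifferentiableAt ℝ u' x) :
    gradInnerAt (u + u') v x = gradInnerAt u v x + gradInnerAt u' v x := by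
  simp only [gradInnerAt, fderiv_add hu hu', add_apply, PiLp.add_apply, add_mul,
    Finset.sum_add_distrib]

theorem gradInnerAt_smul_left (c : ℝ) : gradInnerAt (c • u) v x = c * gradInnerAt u v x := by
  simp only [gradInnerAt, fderiv_const_smul_field, Pi.smul_apply, smul_apply, PiLp.smul_apply,
    smul_eq_mul, Finset.mul_sum, mul_assoc]

theorem continuous_fderiv_apply_coord (hg : ContDiff ℝ 1 g) (w : E3) (i : Fin 3) :
    Continuous fun x => (fderiv ℝ g x w) i :=
  (EuclideanSpace.proj (𝕜 := ℝ) i).continuous.comp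
    ((hg.continuous_fderiv one_ne_zero).clm_apply continuous_const)

theorem continuous_divAt (hg : ContDiff ℝ 1 g) : Continuous (divAt g) :=
  continuous_finsetSum _ fun _ _ => continuous_fderiv_apply_coord hg _ _

theorem continuous_gradInnerAt (hg : ContDiff ℝ 1 g) (hh : ContDiff ℝ 1 h) :
    Continuous (gradInnerAt g h) :=
  continuous_finsetSum _ fun _ _ => continuous_finsetSum _ fun _ _ =>
    (continuous_fderiv_apply_coord hg _ _).mul (continuous_fderiv_apply_coord hh _ _)

theorem gradInnerAt_self_nonneg (v : E3 → E3) (x : E3) : 0 ≤ gradInnerAt v v x :=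
  Finset.sum_nonneg fun _ _ => Finset.sum_nonneg fun _ _ => mul_self_nonneg _

theorem fderiv_eq_zero_of_gradInnerAt_self (hv : gradInnerAt v v x = 0) : fderiv ℝ v x = 0 := by
  have hentry (i j : Fin 3) : (fderiv ℝ v x (EuclideanSpace.single j 1)) i = 0 := by
    have hrow := (Finset.sum_eq_zero_iff_of_nonneg fun i _ =>
      Finset.sum_nonneg fun j _ => mul_self_nonneg _).1 hv i (Finset.mem_univ i)
    exact mul_self_eq_zero.1 ((Finset.sum_eq_zero_iff_of_nonneg fun j _ =>
      mul_self_nonneg _).1 hrow j (Finset.mem_univ j))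
  refine ContinuousLinearMap.coe_injective ((EuclideanSpace.basisFun (Fin 3) ℝ).toBasis.ext ?_)
  intro j
  ext i
  simpa using hentry i j

end PointwiseForms

section MappedBubble

open Finset

variable (b : AffineBasis (Fin 4) ℝ E3)

theorem mappedBubble_eq_sum_smul (x : E3) :
    mappedBubble b x = ∑ k, refBubble (fun j => b.coord j.succ x) k • (b k.succ - b 0) := by
  have hinv : (jacobiMatrix b)⁻¹ = Matrix.of fun j m =>
      (b.coord (Fin.succ j)).linear (EuclideanSpace.single m 1) := by
    refine Matrix.inv_eq_left_inv (Matrix.ext fun j k => ?_)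
    have h := coord_linear_sub b j.succ k.succ 0
    rw [linearMap_eq_sum_mul_single] at h
    simpa [Matrix.mul_apply, Matrix.one_apply, jacobiMatrix, mul_comm] using h
  have hcoord : (jacobiMatrix b)⁻¹.mulVec (x - b 0).ofLp = fun j => b.coord j.succ x := by
    ext j
    have h := affineMap_add_apply (b.coord j.succ) (b 0) (x - b 0)
    rw [add_sub_cancel, b.coord_apply_ne (Fin.succ_ne_zero j), zero_add,
      linearMap_eq_sum_mul_single] at h
    simpa [hinv, Matrix.mulVec, dotProduct, mul_comm] using h.symm
  rw [mappedBubble, hcoord]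
  ext m
  simp [Matrix.mulVec, dotProduct, jacobiMatrix, mul_comm]

theorem contDiff_mappedBubble {n : WithTop ℕ∞} : ContDiff ℝ n (mappedBubble b) := by
  rw [funext (mappedBubble_eq_sum_smul b)]
  refine ContDiff.sum fun k _ => ContDiff.fun_smul ?_ contDiff_const
  exact contDiff_pi.1 (contDiff_refBubble.comp (contDiff_pi.2 fun j => contDiff_affineMap _)) k

theorem divAt_mappedBubble (x : E3) :
    divAt (mappedBubble b) x = 4 * b.coord 1 x * (b.coord 1 x - b.coord 2 x - b.coord 3 x) := by
  set s : Fin 3 → ℝ := fun j => b.coord j.succ x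
  have hd (k : Fin 3) : DifferentiableAt ℝ (fun y => refBubble (fun j => b.coord j.succ y) k) x :=
    (contDiff_pi.1 (contDiff_refBubble.comp (contDiff_pi.2 fun j => contDiff_affineMap
      (n := 1) (b.coord (Fin.succ j)))) k).differentiable one_ne_zero x
  have hpartial (k : Fin 3) :
      fderiv ℝ (fun y => refBubble (fun j => b.coord j.succ y) k) x (b k.succ - b 0) =
        deriv (fun t => refBubble (Function.update s k t) k) (s k) := by
    have hline (t : ℝ) : (fun j : Fin 3 => b.coord j.succ (x + t • (b k.succ - b 0))) =
        Function.update s k (s k + t) := by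
      ext j
      rw [affineMap_add_apply, map_smul, coord_linear_sub]
      obtain rfl | hj := eq_or_ne j k <;> simp [s, Fin.succ_ne_zero, *]
    rw [← (hd k).lineDeriv_eq_fderiv, lineDeriv]
    simp only [hline]
    rw [deriv_comp_const_add (f := fun t => refBubble (Function.update s k t) k), add_zero]
  rw [funext (mappedBubble_eq_sum_smul b), divAt_sum_smul fun k _ => hd k,
    sum_congr rfl fun k _ => hpartial k, sum_deriv_refBubble]
  rfl

end MappedBubble

section BubbleIndependence

open Finset

/-- The homogeneous part of degree four of `mappedBubble b`, as a function of the direction. -/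
noncomputable def mappedLeadingForm (b : AffineBasis (Fin 4) ℝ E3) (w : E3) : E3 :=
  ∑ k, leadingForm (fun j => (b.coord j.succ).linear w) k • (b k.succ - b 0)

theorem mappedLeadingForm_smul (b : AffineBasis (Fin 4) ℝ E3) (c : ℝ) (w : E3) :
    mappedLeadingForm b (c • w) = c ^ 4 • mappedLeadingForm b w := by
  have h : (fun j : Fin 3 => (b.coord j.succ).linear (c • w)) =
      c • fun j => (b.coord j.succ).linear w := funext fun j => map_smul _ c w
  simp only [mappedLeadingForm, h, leadingForm_smul, Pi.smul_apply, smul_sum, smul_assoc]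

theorem fwdDiff_iter_mappedBubble (b : AffineBasis (Fin 4) ℝ E3) (x w : E3) :
    (fwdDiff w)^[4] (mappedBubble b) x = (24 : ℝ) • mappedLeadingForm b w := by
  have hcoord (k : ℕ) : (fun j : Fin 3 => b.coord j.succ (x + k • w)) =
      (fun j => b.coord j.succ x) + k • fun j => (b.coord j.succ).linear w := by
    ext j
    rw [affineMap_add_apply, map_nsmul]
    rfl
  have h := fwdDiff_iter_refBubble (fun j => (b.coord j.succ).linear w) (fun j => b.coord j.succ x)
  rw [fwdDiff_iter_eq_sum_shift] at h ⊢
  simp only [mappedBubble_eq_sum_smul, hcoord, mappedLeadingForm, smul_sum, ← smul_assoc]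
  rw [sum_comm]
  refine sum_congr rfl fun k _ => ?_
  rw [← sum_smul]
  congr 1
  simpa using congrFun h k

theorem sum_smul_mappedLeadingForm_eq_zero {ι : Type*} [Fintype ι]
    {b : ι → AffineBasis (Fin 4) ℝ E3} {d : ι → ℝ} {q : Fin 3 → MvPolynomial (Fin 3) ℝ}
    (hq : ∀ m, (q m).totalDegree < 4) {U : Set E3} (hU : IsOpen U) (hne : U.Nonempty)
    (h : ∀ x ∈ U, ∀ m, (∑ i, d i • mappedBubble (b i) x) m = MvPolynomial.eval x.ofLp (q m))
    (w : E3) : ∑ i, d i • mappedLeadingForm (b i) w = 0 := by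
  obtain ⟨x, hx⟩ := hne
  have hmem : ∀ᶠ ε in nhds (0 : ℝ), ∀ k ∈ range 5, x + k • ε • w ∈ U := by
    refine (Filter.eventually_all_finset _).2 fun k _ => ?_
    have hcont : Continuous fun ε : ℝ => x + k • ε • w := by fun_prop
    exact hcont.continuousAt.eventually_mem (hU.mem_nhds (by simpa using hx))
  obtain ⟨ε, hε, hε0⟩ := ((hmem.filter_mono nhdsWithin_le_nhds).and
    (self_mem_nhdsWithin (a := (0 : ℝ)) (s := {0}ᶜ))).exists
  have hcubic (m : Fin 3) :
      ((fwdDiff (ε • w))^[4] (∑ i, d i • mappedBubble (b i)) x).ofLp m = 0 := by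
    rw [← fwdDiff_iter_eval_eq_zero (hq m) x.ofLp (ε • w).ofLp, fwdDiff_iter_eq_sum_shift,
      fwdDiff_iter_eq_sum_shift, WithLp.ofLp_sum, Finset.sum_apply]
    refine sum_congr rfl fun k hk => ?_
    have hval : _ = MvPolynomial.eval (x.ofLp + k • (ε • w).ofLp) (q m) := h _ (hε k hk) m
    rw [← hval, Finset.sum_apply]
    rfl
  have hquartic : (fwdDiff (ε • w))^[4] (∑ i, d i • mappedBubble (b i)) x =
      (24 * ε ^ 4) • ∑ i, d i • mappedLeadingForm (b i) w := by
    rw [fwdDiff_iter_finsetSum, Finset.sum_apply, smul_sum]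
    refine sum_congr rfl fun i _ => ?_
    rw [fwdDiff_iter_const_smul, Pi.smul_apply, fwdDiff_iter_mappedBubble, mappedLeadingForm_smul,
      smul_smul (24 : ℝ), smul_comm]
  have hzero : (24 * ε ^ 4) • ∑ i, d i • mappedLeadingForm (b i) w = 0 :=
    hquartic ▸ PiLp.ext hcubic
  exact (smul_eq_zero.1 hzero).resolve_left
    (mul_ne_zero (by norm_num) (pow_ne_zero 4 hε0))

theorem renumbering_bijective (i : Fin 9) : Function.Bijective (renumbering i) := by
  rw [← Finite.injective_iff_bijective]
  revert i
  decide

/-- The barycentric frame `b` with its points numbered by the `i`-th renumbering. -/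
noncomputable def renumberedBasis (b : AffineBasis (Fin 4) ℝ E3) (i : Fin 9) :
    AffineBasis (Fin 4) ℝ E3 :=
  b.reindex (Equiv.ofBijective _ (renumbering_bijective i)).symm

variable (b : AffineBasis (Fin 4) ℝ E3)

theorem renumberedBasis_apply (i : Fin 9) (k : Fin 4) :
    renumberedBasis b i k = b (renumbering i k) := rfl

theorem coord_renumberedBasis (i : Fin 9) (k : Fin 4) :
    (renumberedBasis b i).coord k = b.coord (renumbering i k) :=
  b.coord_reindex _ k

theorem range_renumberedBasis (i : Fin 9) : Set.range (renumberedBasis b i) = Set.range b :=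
  (renumbering_bijective i).surjective.range_comp b

set_option maxHeartbeats 1000000 in
-- `simp` writes out nine instances of the nine quartic forms.
/-- The hypotheses are the `m`-th barycentric coordinates of the combined quartic parts in the
direction `b p - b l`; the nine of them used here form an invertible system. -/
theorem eq_zero_of_sum_leadingForm_eq_zero {d : Fin 9 → ℝ}
    (h : ∀ p l m : Fin 4, ∑ i, d i * ∑ n : Fin 3, leadingForm
      (fun j => (if renumbering i j.succ = p then 1 else 0) -
        if renumbering i j.succ = l then 1 else 0) n *
        ((if m = renumbering i n.succ then 1 else 0) - if m = renumbering i 0 then 1 else 0)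
        = 0) (i : Fin 9) : d i = 0 := by
  have h1 := h 0 1 0
  have h2 := h 0 1 1
  have h3 := h 0 1 2
  have h4 := h 0 2 0
  have h5 := h 0 2 1
  have h6 := h 0 2 2
  have h7 := h 0 3 0
  have h8 := h 0 3 1
  have h9 := h 0 3 2
  clear h
  simp [Fin.sum_univ_succ, renumbering, leadingForm] at h1 h2 h3 h4 h5 h6 h7 h8 h9
  fin_cases i <;> simp only [Fin.isValue, Fin.zero_eta, Fin.mk_one, Fin.reduceFinMk] <;> linarith

theorem bubble_coeff_eq_zero {d : Fin 9 → ℝ} {q : Fin 3 → MvPolynomial (Fin 3) ℝ}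
    (hq : ∀ m, (q m).totalDegree < 4) {U : Set E3} (hU : IsOpen U) (hne : U.Nonempty)
    (h : ∀ x ∈ U, ∀ m, (∑ i, d i • mappedBubble (fun k => b (renumbering i k)) x) m =
      MvPolynomial.eval x.ofLp (q m)) : ∀ i, d i = 0 := by
  refine eq_zero_of_sum_leadingForm_eq_zero fun p l m => ?_
  have hlead := congrArg (b.coord m).linear (sum_smul_mappedLeadingForm_eq_zero
    (b := renumberedBasis b) hq hU hne h (b p - b l))
  simpa only [mappedLeadingForm, map_sum, map_smul, coord_renumberedBasis, renumberedBasis_apply,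
    coord_linear_sub, smul_eq_mul, map_zero] using hlead

end BubbleIndependence

section BubbleMoments

open Finset Nat

theorem memLp_restrict_of_continuousOn_closure {X E : Type*} [TopologicalSpace X]
    [MeasurableSpace X] [OpensMeasurableSpace X] [TopologicalSpace.PseudoMetrizableSpace X]
    {μ : Measure X} [IsFiniteMeasureOnCompacts μ] [NormedAddCommGroup E] {s : Set X}
    (hs : IsCompact (closure s)) {f : X → E} (hf : ContinuousOn f (closure s)) {p : ENNReal} :
    MemLp f p (μ.restrict s) := by
  have hfin : IsFiniteMeasure (μ.restrict (closure s)) :=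
    isFiniteMeasure_restrict.2 hs.measure_lt_top.ne
  obtain ⟨C, hC⟩ := hs.exists_bound_of_continuousOn hf
  exact (MemLp.of_bound (hf.aestronglyMeasurable_of_isCompact hs isClosed_closure.measurableSet) C
    (ae_restrict_of_forall_mem isClosed_closure.measurableSet hC)).mono_measure
    (Measure.restrict_mono subset_closure le_rfl)

theorem integrableOn_interior_convexHull {ι E : Type*} [Finite ι] [NormedAddCommGroup E]
    [NormedSpace ℝ E] [MeasurableSpace E] [OpensMeasurableSpace E] {μ : Measure E}
    [IsFiniteMeasureOnCompacts μ] (a : ι → E) {f : E → ℝ} (hf : Continuous f) :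
    IntegrableOn f (interior (convexHull ℝ (Set.range a))) μ :=
  (hf.continuousOn.integrableOn_compact ((Set.finite_range a).isCompact_convexHull ℝ)).mono_set
    interior_subset

theorem measureReal_interior_convexHull_pos {ι E : Type*} [Finite ι] [NormedAddCommGroup E]
    [NormedSpace ℝ E] [MeasurableSpace E] {μ : Measure E} [μ.IsOpenPosMeasure]
    [IsFiniteMeasureOnCompacts μ] (b : AffineBasis ι ℝ E) :
    0 < μ.real (interior (convexHull ℝ (Set.range b))) := by
  cases nonempty_fintype ι
  exact ENNReal.toReal_pos
    (isOpen_interior.measure_pos μ ⟨_, b.centroid_mem_interior_convexHull⟩).ne'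
    ((measure_mono interior_subset).trans_lt
      ((Set.finite_range b).isCompact_convexHull ℝ).measure_lt_top).ne

variable (b : AffineBasis (Fin 4) ℝ E3)

theorem setIntegral_prod_coord_four (i j k l : Fin 4) :
    ∫ x in interior (convexHull ℝ (Set.range b)),
      b.coord i x * b.coord j x * (b.coord k x * b.coord l x) =
    volume.real (interior (convexHull ℝ (Set.range b))) / 840 *
      ∏ m, (((Pi.single i 1 + Pi.single j 1 + Pi.single k 1 + Pi.single l 1 :
        Fin 4 → ℕ) m)! : ℝ) := by
  have hsingle (c : Fin 4 → ℝ) (i : Fin 4) : ∏ m, c m ^ (Pi.single i 1 : Fin 4 → ℕ) m = c i := by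
    simp [Pi.single_apply]
  have h := setIntegral_prod_coord_pow b volume
    (Pi.single i 1 + Pi.single j 1 + Pi.single k 1 + Pi.single l 1)
  simp only [Pi.add_apply, pow_add, prod_mul_distrib, hsingle, sum_add_distrib,
    sum_pi_single', mem_univ, if_true, ← mul_assoc] at h ⊢
  rw [h]
  norm_num [Nat.factorial]
  ring

/-- The moments of `divAt (mappedBubble b)` against the products `b.coord k * b.coord l`, in units
of the volume of the tetrahedron divided by `210`. -/
def divMoment : Fin 4 → Fin 4 → ℝ :=
  ![![0, 2, -1, -1], ![2, 12, 0, 0], ![-1, 0, -4, -2], ![-1, 0, -2, -4]]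

theorem setIntegral_divAt_mappedBubble_mul_coord (k l : Fin 4) :
    ∫ x in interior (convexHull ℝ (Set.range b)),
      divAt (mappedBubble b) x * (b.coord k x * b.coord l x) =
    volume.real (interior (convexHull ℝ (Set.range b))) / 210 * divMoment k l := by
  have hint (i : Fin 4) : IntegrableOn
      (fun x => b.coord 1 x * b.coord i x * (b.coord k x * b.coord l x))
      (interior (convexHull ℝ (Set.range b))) := by
    have hcoord := continuous_barycentric_coord b
    exact integrableOn_interior_convexHull b (by fun_prop)
  have hsplit (x : E3) : divAt (mappedBubble b) x * (b.coord k x * b.coord l x) =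
      4 * (b.coord 1 x * b.coord 1 x * (b.coord k x * b.coord l x) -
        b.coord 1 x * b.coord 2 x * (b.coord k x * b.coord l x) -
        b.coord 1 x * b.coord 3 x * (b.coord k x * b.coord l x)) := by
    rw [divAt_mappedBubble]
    ring
  simp only [hsplit]
  rw [integral_const_mul, integral_sub ((hint 1).sub' (hint 2)) (hint 3),
    integral_sub (hint 1) (hint 2)]
  simp only [setIntegral_prod_coord_four]
  fin_cases k <;> fin_cases l <;>
    simp [divMoment, Fin.prod_univ_succ, Pi.single_apply, Fin.succ_ne_zero, factorial] <;> ring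

theorem setIntegral_divAt_mappedBubble_mul_quadraticForm (C : Fin 4 → Fin 4 → ℝ) :
    ∫ x in interior (convexHull ℝ (Set.range b)),
      divAt (mappedBubble b) x * ∑ k, ∑ l, C k l * (b.coord k x * b.coord l x) =
    volume.real (interior (convexHull ℝ (Set.range b))) / 210 *
      ∑ k, ∑ l, C k l * divMoment k l := by
  have hint (k l : Fin 4) := (integrableOn_interior_convexHull (μ := volume) b
    (f := fun x => divAt (mappedBubble b) x * (b.coord k x * b.coord l x))
    ((continuous_divAt (contDiff_mappedBubble b)).mul ((continuous_barycentric_coord b k).mul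
      (continuous_barycentric_coord b l)))).const_mul (C k l)
  simp only [mul_sum, mul_left_comm _ (C _ _)]
  rw [integral_finsetSum _ fun k _ => integrable_finsetSum _ fun l _ => hint k l]
  refine sum_congr rfl fun k _ => ?_
  rw [integral_finsetSum _ fun l _ => hint k l]
  simp only [integral_const_mul, setIntegral_divAt_mappedBubble_mul_coord]

theorem add_transpose_eq_of_sum_divMoment_eq_zero {C : Fin 4 → Fin 4 → ℝ}
    (h : ∀ i, ∑ k, ∑ l, C (renumbering i k) (renumbering i l) * divMoment k l = 0)
    (k l : Fin 4) : C k l + C l k = 2 * C 0 0 := by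
  have h0 := h 0
  have h1 := h 1
  have h2 := h 2
  have h3 := h 3
  have h4 := h 4
  have h5 := h 5
  have h6 := h 6
  have h7 := h 7
  have h8 := h 8
  clear h
  simp [Fin.sum_univ_succ, renumbering, divMoment] at h0 h1 h2 h3 h4 h5 h6 h7 h8
  fin_cases k <;> fin_cases l <;>
    simp only [Fin.isValue, Fin.zero_eta, Fin.mk_one, Fin.reduceFinMk] <;> linarith

theorem eval_eq_const_of_orthogonal_bubbles {q : MvPolynomial (Fin 3) ℝ}
    (hq : q ∈ MvPolynomial.restrictTotalDegree (Fin 3) ℝ 2)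
    (horth : ∀ i, ∫ x in interior (convexHull ℝ (Set.range b)),
      divAt (mappedBubble fun k => b (renumbering i k)) x * MvPolynomial.eval x.ofLp q = 0) :
    ∃ c, ∀ x : E3, MvPolynomial.eval x.ofLp q = c := by
  obtain ⟨C, hC⟩ := exists_quadraticForm_coord b hq
  have hvol := measureReal_interior_convexHull_pos (μ := volume) b
  have hsymm := add_transpose_eq_of_sum_divMoment_eq_zero (C := C) fun i => by
    have hrenumber (x : E3) : MvPolynomial.eval x.ofLp q =
        ∑ k, ∑ l, C (renumbering i k) (renumbering i l) *
          ((renumberedBasis b i).coord k x * (renumberedBasis b i).coord l x) := by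
      simp only [coord_renumberedBasis]
      rw [hC, ← (renumbering_bijective i).sum_comp]
      exact sum_congr rfl fun k _ => ((renumbering_bijective i).sum_comp _).symm
    have h := horth i
    simp only [hrenumber] at h
    rw [← range_renumberedBasis b i] at h hvol
    have hmoment := setIntegral_divAt_mappedBubble_mul_quadraticForm (renumberedBasis b i)
      fun k l => C (renumbering i k) (renumbering i l)
    exact (_root_.mul_eq_zero.1 (hmoment.symm.trans h)).resolve_left (by positivity)
  refine ⟨C 0 0, fun x => ?_⟩
  have hswap : ∑ k, ∑ l, C l k * (b.coord k x * b.coord l x) =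
      ∑ k, ∑ l, C k l * (b.coord k x * b.coord l x) := by
    rw [sum_comm]
    exact sum_congr rfl fun k _ => sum_congr rfl fun l _ => by rw [mul_comm (b.coord l x)]
  have hdouble : ∑ k, ∑ l, (C k l + C l k) * (b.coord k x * b.coord l x) = 2 * C 0 0 := by
    simp only [hsymm, ← mul_sum, b.sum_coord_apply_eq_one, mul_one]
  simp only [add_mul, sum_add_distrib, hswap] at hdouble
  rw [hC]
  linarith

end BubbleMoments

namespace TetMesh

variable {Ω : Set E3} (M : TetMesh Ω)

/-- The vertices of the tetrahedron `T` as an affine basis of the space. -/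
noncomputable def basis (T : Fin M.nt) : AffineBasis (Fin 4) ℝ E3 where
  toFun := M.vertex T
  ind' := M.affineIndependent T
  tot' := by
    rw [(M.affineIndependent T).affineSpan_eq_top_iff_card_eq_finrank_add_one]
    simp

theorem tet_eq (T : Fin M.nt) : M.tet T = convexHull ℝ (Set.range (M.basis T)) := rfl

theorem isCompact_tet (T : Fin M.nt) : IsCompact (M.tet T) :=
  (Set.finite_range _).isCompact_convexHull ℝ

theorem convex_tet (T : Fin M.nt) : Convex ℝ (M.tet T) := convex_convexHull ℝ _

theorem mem_interior_tet_iff {T : Fin M.nt} {x : E3} :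
    x ∈ interior (M.tet T) ↔ ∀ i, 0 < (M.basis T).coord i x := by
  rw [tet_eq, (M.basis T).interior_convexHull, Set.mem_ofPred_eq]

theorem nonempty_interior_tet (T : Fin M.nt) : (interior (M.tet T)).Nonempty :=
  ⟨_, (M.basis T).centroid_mem_interior_convexHull⟩

theorem closure_interior_tet (T : Fin M.nt) : closure (interior (M.tet T)) = M.tet T := by
  rw [(M.convex_tet T).closure_interior_eq_closure_of_nonempty_interior
    (M.nonempty_interior_tet T), (M.isCompact_tet T).isClosed.closure_eq]

theorem iUnion_tet : ⋃ T, M.tet T = closure Ω := M.cover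

theorem exists_mem_tet {x : E3} (hx : x ∈ closure Ω) : ∃ T, x ∈ M.tet T := by
  rwa [← Set.mem_iUnion, M.iUnion_tet]

theorem tet_subset (T : Fin M.nt) : M.tet T ⊆ closure Ω :=
  M.iUnion_tet ▸ Set.subset_iUnion _ T

theorem isCompact_closure {Ω : Set E3} (M : TetMesh Ω) : IsCompact (closure Ω) :=
  M.iUnion_tet ▸ isCompact_iUnion M.isCompact_tet

theorem interior_tet_subset (hreg : interior (closure Ω) = Ω) (T : Fin M.nt) :
    interior (M.tet T) ⊆ Ω :=
  (interior_mono (M.tet_subset T)).trans hreg.subset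

theorem exists_vertex_notMem {T T' : Fin M.nt} (h : T ≠ T') :
    ∃ i, M.vertex T i ∉ Set.range (M.vertex T') := by
  have hncard (S : Fin M.nt) : (Set.range (M.vertex S)).ncard = 4 := by
    rw [Set.ncard_range_of_injective (M.affineIndependent S).injective, Nat.card_fin]
  by_contra! hc
  exact M.range_ne T T' h (Set.eq_of_subset_of_ncard_le (Set.range_subset_iff.2 hc)
    ((hncard T').trans (hncard T).symm).le)

theorem coord_eq_zero_of_mem_inter {T T' : Fin M.nt} (h : T ≠ T') {b : AffineBasis (Fin 4) ℝ E3}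
    (hb : Set.range b = Set.range (M.vertex T)) {i : Fin 4} (hi : b i ∉ Set.range (M.vertex T'))
    {x : E3} (hx : x ∈ M.tet T) (hx' : x ∈ M.tet T') : b.coord i x = 0 := by
  have hmem : x ∈ convexHull ℝ (Set.range b ∩ Set.range (M.vertex T')) := by
    rw [hb, ← M.inter_eq T T' h]
    exact ⟨hx, hx'⟩
  refine convexHull_min (t := b.coord i ⁻¹' {0}) ?_
    ((convex_singleton 0).affine_preimage _) hmem
  rintro _ ⟨⟨j, rfl⟩, hj⟩
  refine b.coord_apply_ne ?_
  rintro rfl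
  exact hi hj

theorem notMem_tet_of_mem_interior {T T' : Fin M.nt} (h : T ≠ T') {x : E3}
    (hx : x ∈ interior (M.tet T)) : x ∉ M.tet T' := by
  intro hx'
  obtain ⟨i, hi⟩ := M.exists_vertex_notMem h
  exact (M.mem_interior_tet_iff.1 hx i).ne'
    (M.coord_eq_zero_of_mem_inter (b := M.basis T) h rfl hi (interior_subset hx) hx')

theorem mem_velocitySpace_iff {v : E3 → E3} : v ∈ M.velocitySpace ↔
    ∃ vc ∈ M.conformingP3, ∃ d : Fin M.nt × Fin 9 → ℝ,
      v = vc + ∑ Ti, d Ti • M.bubble Ti.1 Ti.2 := by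
  simp only [velocitySpace, Submodule.mem_sup, Submodule.mem_span_range_iff_exists_fun,
    exists_exists_eq_and, eq_comm (a := v)]

theorem bubble_mem_velocitySpace (T : Fin M.nt) (i : Fin 9) : M.bubble T i ∈ M.velocitySpace :=
  Submodule.mem_sup_right (Submodule.subset_span ⟨(T, i), rfl⟩)

theorem bubble_apply_of_ne {S T : Fin M.nt} (h : S ≠ T) (i : Fin 9) {x : E3}
    (hx : x ∈ interior (M.tet T)) : M.bubble S i x = 0 :=
  Set.indicator_of_notMem (fun hx' => M.notMem_tet_of_mem_interior h hx' (interior_subset hx)) _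

theorem bubble_apply_self {T : Fin M.nt} (i : Fin 9) {x : E3} (hx : x ∈ interior (M.tet T)) :
    M.bubble T i x = mappedBubble (fun k => M.basis T (renumbering i k)) x :=
  Set.indicator_of_mem hx _

theorem sum_bubble_apply (d : Fin M.nt × Fin 9 → ℝ) {T : Fin M.nt} {x : E3}
    (hx : x ∈ interior (M.tet T)) : (∑ Ti, d Ti • M.bubble Ti.1 Ti.2) x =
      ∑ i, d (T, i) • mappedBubble (fun k => M.basis T (renumbering i k)) x := by
  simp only [Finset.sum_apply, Pi.smul_apply, Fintype.sum_prod_type]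
  rw [Finset.sum_eq_single T]
  · exact Finset.sum_congr rfl fun i _ => by rw [M.bubble_apply_self i hx]
  · intro S _ hS
    exact Finset.sum_eq_zero fun i _ => by rw [M.bubble_apply_of_ne hS i hx, smul_zero]
  · exact fun hT => (hT (Finset.mem_univ T)).elim

theorem contDiff_mappedBubble_renumbering (T : Fin M.nt) (i : Fin 9) {n : WithTop ℕ∞} :
    ContDiff ℝ n (mappedBubble fun k => M.basis T (renumbering i k)) :=
  contDiff_mappedBubble (renumberedBasis (M.basis T) i)

end TetMesh

namespace TetMesh

variable {Ω : Set E3} (M : TetMesh Ω)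

/-- A vector field is piecewise `C¹` if on every open tetrahedron it agrees with a `C¹` field on
the whole space; the broken forms are bilinear on such fields. -/
def PiecewiseC1 (v : E3 → E3) : Prop :=
  ∀ T, ∃ g : E3 → E3, ContDiff ℝ 1 g ∧ Set.EqOn v g (interior (M.tet T))

theorem piecewiseC1_of_mem_velocitySpace {v : E3 → E3} (hv : v ∈ M.velocitySpace) :
    M.PiecewiseC1 v := by
  intro T
  obtain ⟨vc, ⟨-, -, hpoly⟩, d, rfl⟩ := M.mem_velocitySpace_iff.1 hv
  choose q _ hqe using hpoly T
  refine ⟨fun x => WithLp.toLp 2 (fun m => MvPolynomial.eval (fun k => x k) (q m)) +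
    ∑ i, d (T, i) • mappedBubble (fun k => M.basis T (renumbering i k)) x, ?_, ?_⟩
  · refine ContDiff.add ?_ (ContDiff.sum fun i _ =>
      (M.contDiff_mappedBubble_renumbering T i).const_smul (d (T, i)))
    simp only [contDiff_euclidean, MvPolynomial.eval_eq']
    fun_prop
  · intro x hx
    simp only [Pi.add_apply, M.sum_bubble_apply d hx]
    congr 1
    ext m
    exact hqe m x (interior_subset hx)

variable {M} {u u' v v' : E3 → E3} {p p' : E3 → ℝ}

theorem eventuallyEq_nhds {g : E3 → E3} {T : Fin M.nt} (hvg : Set.EqOn v g (interior (M.tet T)))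
    {x : E3} (hx : x ∈ interior (M.tet T)) : v =ᶠ[nhds x] g :=
  hvg.eventuallyEq_of_mem (isOpen_interior.mem_nhds hx)

theorem PiecewiseC1.differentiableAt (hv : M.PiecewiseC1 v) {T : Fin M.nt} {x : E3}
    (hx : x ∈ interior (M.tet T)) : DifferentiableAt ℝ v x := by
  obtain ⟨g, hg, hvg⟩ := hv T
  exact (hg.differentiable one_ne_zero x).congr_of_eventuallyEq (eventuallyEq_nhds hvg hx)

theorem PiecewiseC1.integrableOn_gradInnerAt (hu : M.PiecewiseC1 u) (hv : M.PiecewiseC1 v)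
    (T : Fin M.nt) : IntegrableOn (gradInnerAt u v) (interior (M.tet T)) := by
  obtain ⟨g, hg, hug⟩ := hu T
  obtain ⟨h, hh, hvh⟩ := hv T
  refine (integrableOn_interior_convexHull (M.vertex T) (continuous_gradInnerAt hg hh)).congr_fun
    (fun x hx => ?_) isOpen_interior.measurableSet
  simp only [gradInnerAt, (eventuallyEq_nhds hug hx).fderiv_eq,
    (eventuallyEq_nhds hvh hx).fderiv_eq]

theorem PiecewiseC1.integrableOn_divAt_mul (hv : M.PiecewiseC1 v) {T : Fin M.nt}
    (hp : IntegrableOn p (interior (M.tet T))) :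
    IntegrableOn (fun x => divAt v x * p x) (interior (M.tet T)) := by
  obtain ⟨g, hg, hvg⟩ := hv T
  refine (hp.continuousOn_mul_of_subset (continuous_divAt hg).continuousOn (M.isCompact_tet T)
    isOpen_interior.measurableSet interior_subset).congr_fun (fun x hx => ?_)
    isOpen_interior.measurableSet
  simp only [divAt, (eventuallyEq_nhds hvg hx).fderiv_eq]

theorem gradForm_comm : M.gradForm u v = M.gradForm v u := by
  simp only [gradForm, gradInnerAt_comm (u := u)]

theorem gradForm_add_left (hu : M.PiecewiseC1 u) (hu' : M.PiecewiseC1 u')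
    (hv : M.PiecewiseC1 v) : M.gradForm (u + u') v = M.gradForm u v + M.gradForm u' v := by
  simp only [gradForm, ← Finset.sum_add_distrib]
  refine Finset.sum_congr rfl fun T _ => ?_
  rw [← integral_add (hu.integrableOn_gradInnerAt hv T) (hu'.integrableOn_gradInnerAt hv T)]
  exact setIntegral_congr_fun isOpen_interior.measurableSet fun x hx =>
    gradInnerAt_add_left (hu.differentiableAt hx) (hu'.differentiableAt hx)

theorem gradForm_smul_left (c : ℝ) : M.gradForm (c • u) v = c * M.gradForm u v := by
  simp only [gradForm, gradInnerAt_smul_left, integral_const_mul, Finset.mul_sum]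

theorem divForm_add_left (hv : M.PiecewiseC1 v) (hv' : M.PiecewiseC1 v')
    (hp : ∀ T, IntegrableOn p (interior (M.tet T))) :
    M.divForm (v + v') p = M.divForm v p + M.divForm v' p := by
  simp only [divForm, ← Finset.sum_add_distrib]
  refine Finset.sum_congr rfl fun T _ => ?_
  rw [← integral_add (hv.integrableOn_divAt_mul (hp T)) (hv'.integrableOn_divAt_mul (hp T))]
  refine setIntegral_congr_fun isOpen_interior.measurableSet fun x hx => ?_
  simp only [divAt_add (hv.differentiableAt hx) (hv'.differentiableAt hx), add_mul]

theorem divForm_smul_left (c : ℝ) : M.divForm (c • v) p = c * M.divForm v p := by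
  simp only [divForm, divAt_smul, mul_assoc, integral_const_mul, Finset.mul_sum]

theorem divForm_add_right (hv : M.PiecewiseC1 v)
    (hp : ∀ T, IntegrableOn p (interior (M.tet T)))
    (hp' : ∀ T, IntegrableOn p' (interior (M.tet T))) :
    M.divForm v (p + p') = M.divForm v p + M.divForm v p' := by
  simp only [divForm, ← Finset.sum_add_distrib]
  refine Finset.sum_congr rfl fun T _ => ?_
  rw [← integral_add (hv.integrableOn_divAt_mul (hp T)) (hv.integrableOn_divAt_mul (hp' T))]
  simp only [Pi.add_apply, mul_add]

theorem divForm_smul_right (c : ℝ) : M.divForm v (c • p) = c * M.divForm v p := by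
  simp only [divForm, Pi.smul_apply, smul_eq_mul, mul_left_comm, integral_const_mul,
    Finset.mul_sum]

theorem divForm_congr_ae (hreg : interior (closure Ω) = Ω) (h : p =ᵐ[volume.restrict Ω] p') :
    M.divForm v p = M.divForm v p' := by
  refine Finset.sum_congr rfl fun T _ => integral_congr_ae ?_
  filter_upwards [ae_restrict_of_ae_restrict_of_subset (M.interior_tet_subset hreg T) h]
    with x hx
  rw [hx]

theorem integrableOn_interior_of_mem_pressureSpace (hreg : interior (closure Ω) = Ω)
    {p : Lp ℝ 2 (volume.restrict Ω)} (hp : p ∈ M.pressureSpace) (T : Fin M.nt) :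
    IntegrableOn p (interior (M.tet T)) :=
  IntegrableOn.mono_set (t := Ω) hp.1.1 (M.interior_tet_subset hreg T)

variable (M)

theorem memLp_of_mem_velocitySpace (hv : v ∈ M.velocitySpace) :
    MemLp v 2 (volume.restrict Ω) := by
  obtain ⟨vc, hvc, d, rfl⟩ := M.mem_velocitySpace_iff.1 hv
  have hmem {w : E3 → E3} (hw : ContinuousOn w (closure Ω)) : MemLp w 2 (volume.restrict Ω) :=
    memLp_restrict_of_continuousOn_closure M.isCompact_closure hw
  exact (hmem hvc.1).add (memLp_finsetSum' _ fun Ti _ =>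
    ((hmem (M.contDiff_mappedBubble_renumbering Ti.1 Ti.2
      (n := 0)).continuous.continuousOn).indicator isOpen_interior.measurableSet).const_smul _)

theorem integrable_inner_of_mem_velocitySpace (f : Lp E3 2 (volume.restrict Ω))
    (hv : v ∈ M.velocitySpace) : Integrable (fun x => inner ℝ (f x) (v x)) (volume.restrict Ω) := by
  have hmem := M.memLp_of_mem_velocitySpace hv
  refine (L2.integrable_inner (𝕜 := ℝ) f hmem.toLp).congr ?_
  filter_upwards [hmem.coeFn_toLp] with x hx
  rw [hx]

/-- The form `(∇u, ∇v)` on the velocity space. -/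
noncomputable def gradBilin : M.velocitySpace →ₗ[ℝ] M.velocitySpace →ₗ[ℝ] ℝ :=
  LinearMap.mk₂ ℝ (fun u v => M.gradForm u v)
    (fun u u' v => gradForm_add_left (M.piecewiseC1_of_mem_velocitySpace u.2)
      (M.piecewiseC1_of_mem_velocitySpace u'.2) (M.piecewiseC1_of_mem_velocitySpace v.2))
    (fun c _ _ => gradForm_smul_left c)
    (fun u v v' => by
      simp only [gradForm_comm (u := u)]
      exact gradForm_add_left (M.piecewiseC1_of_mem_velocitySpace v.2)
        (M.piecewiseC1_of_mem_velocitySpace v'.2) (M.piecewiseC1_of_mem_velocitySpace u.2))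
    (fun c u _ => by
      simp only [gradForm_comm (u := u)]
      exact gradForm_smul_left c)

/-- The form `(div v, p)` on the product of the velocity and the pressure space. -/
noncomputable def divBilin (hreg : interior (closure Ω) = Ω) :
    M.velocitySpace →ₗ[ℝ] M.pressureSpace →ₗ[ℝ] ℝ :=
  LinearMap.mk₂ ℝ (fun v p => M.divForm v (p : Lp ℝ 2 (volume.restrict Ω)))
    (fun v v' p => divForm_add_left (M.piecewiseC1_of_mem_velocitySpace v.2)
      (M.piecewiseC1_of_mem_velocitySpace v'.2)
      (integrableOn_interior_of_mem_pressureSpace hreg p.2))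
    (fun c _ _ => divForm_smul_left c)
    (fun v p p' => (divForm_congr_ae hreg (Lp.coeFn_add _ _)).trans
      (divForm_add_right (M.piecewiseC1_of_mem_velocitySpace v.2)
        (integrableOn_interior_of_mem_pressureSpace hreg p.2)
        (integrableOn_interior_of_mem_pressureSpace hreg p'.2)))
    (fun c _ _ => (divForm_congr_ae hreg (Lp.coeFn_smul _ _)).trans (divForm_smul_right c))

/-- The functional `v ↦ (f, v)` on the velocity space. -/
noncomputable def loadFunctional (f : Lp E3 2 (volume.restrict Ω)) : M.velocitySpace →ₗ[ℝ] ℝ where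
  toFun v := ∫ x in Ω, inner ℝ (f x) ((v : E3 → E3) x)
  map_add' v v' := by
    rw [← integral_add (M.integrable_inner_of_mem_velocitySpace f v.2)
      (M.integrable_inner_of_mem_velocitySpace f v'.2)]
    simp only [Submodule.coe_add, Pi.add_apply, inner_add_right]
  map_smul' c v := by
    simp only [RingHom.id_apply, smul_eq_mul, ← integral_const_mul, Submodule.coe_smul,
      Pi.smul_apply, real_inner_smul_right]

instance finiteDimensional_conformingP3 : FiniteDimensional ℝ M.conformingP3 := by
  let R : Submodule ℝ
      ((Fin M.nt → Fin 3 → MvPolynomial.restrictTotalDegree (Fin 3) ℝ 3) × (E3 → E3)) :=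
    { carrier := {qv | (∀ x ∉ Ω, qv.2 x = 0) ∧ ∀ T, ∀ x ∈ M.tet T, ∀ m,
        qv.2 x m = MvPolynomial.eval (fun k => x k) (qv.1 T m : MvPolynomial (Fin 3) ℝ)}
      zero_mem' := by simp
      add_mem' := fun ha hb => ⟨fun x hx => by simp [ha.1 x hx, hb.1 x hx],
        fun T x hx m => by simp [ha.2 T x hx m, hb.2 T x hx m]⟩
      smul_mem' := fun c _ ha => ⟨fun x hx => by simp [ha.1 x hx],
        fun T x hx m => by simp [ha.2 T x hx m]⟩ }
  refine finiteDimensional_of_linearRelation R ?_ _ ?_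
  · rintro v ⟨hout, hpoly⟩
    ext x m
    by_cases hx : x ∈ Ω
    · obtain ⟨T, hT⟩ := M.exists_mem_tet (subset_closure hx)
      simpa using hpoly T x hT m
    · exact PiLp.ext_iff.1 (hout x hx) m
  · rintro v ⟨-, hout, hpoly⟩
    choose q hq hqe using hpoly
    exact ⟨fun T m => ⟨q T m, hq T m⟩, hout, fun T x hx m => hqe T m x hx⟩

instance finiteDimensional_velocitySpace : FiniteDimensional ℝ M.velocitySpace := by
  have := FiniteDimensional.span_of_finite ℝ
    (Set.finite_range fun Ti : Fin M.nt × Fin 9 => M.bubble Ti.1 Ti.2)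
  exact Submodule.finiteDimensional_sup _ _

theorem ae_exists_mem_tet : ∀ᵐ x ∂(volume.restrict Ω), ∃ T, x ∈ M.tet T := by
  filter_upwards [ae_restrict_of_ae_restrict_of_subset subset_closure
    (ae_restrict_mem (isClosed_closure (s := Ω)).measurableSet)] with x hx
  exact M.exists_mem_tet hx

instance finiteDimensional_pressureSpace : FiniteDimensional ℝ M.pressureSpace := by
  let R : Submodule ℝ ((Fin M.nt → MvPolynomial.restrictTotalDegree (Fin 3) ℝ 2) ×
      Lp ℝ 2 (volume.restrict Ω)) :=
    { carrier := {qp | ∀ T, ∀ᵐ x ∂(volume.restrict Ω), x ∈ M.tet T →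
        qp.2 x = MvPolynomial.eval (fun k => x k) (qp.1 T : MvPolynomial (Fin 3) ℝ)}
      zero_mem' := fun T => by
        filter_upwards [Lp.coeFn_zero ℝ 2 (volume.restrict Ω)] with x hx _
        exact hx.trans (by simp)
      add_mem' := fun {a b} ha hb T => by
        filter_upwards [Lp.coeFn_add a.2 b.2, ha T, hb T] with x hx h1 h2 hxT
        exact hx.trans (by simp [h1 hxT, h2 hxT])
      smul_mem' := fun c a ha T => by
        filter_upwards [Lp.coeFn_smul c a.2, ha T] with x hx h1 hxT
        exact hx.trans (by simp [h1 hxT]) }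
  refine finiteDimensional_of_linearRelation R (fun p h0 => Lp.ext ?_) _ ?_
  · filter_upwards [ae_all_iff.2 h0, Lp.coeFn_zero ℝ 2 (volume.restrict Ω), M.ae_exists_mem_tet]
      with x hx hx0 ⟨T, hT⟩
    rw [hx T hT, hx0]
    simp
  · rintro p ⟨-, hp⟩
    choose q hq hqe using hp
    exact ⟨fun T => ⟨q T, hq T⟩, hqe⟩

end TetMesh

theorem nonempty_closure_diff_of_isCompact {E : Type*} [TopologicalSpace E] [PreconnectedSpace E]
    [NoncompactSpace E] {Ω : Set E} (hc : IsCompact (closure Ω)) (hne : Ω.Nonempty)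
    (hopen : IsOpen Ω) : (closure Ω \ Ω).Nonempty := by
  rw [← hopen.frontier_eq, nonempty_frontier_iff]
  refine ⟨hne, ?_⟩
  rintro rfl
  rw [closure_univ] at hc
  exact noncompact_univ E hc

namespace TetMesh

variable {Ω : Set E3} {M : TetMesh Ω} {u : E3 → E3}

theorem PiecewiseC1.exists_const_of_gradForm_self (hu : M.PiecewiseC1 u)
    (h : M.gradForm u u = 0) (T : Fin M.nt) : ∃ c, ∀ x ∈ interior (M.tet T), u x = c := by
  obtain ⟨g, hg, hug⟩ := hu T
  have hint : ∫ x in interior (M.tet T), gradInnerAt u u x = 0 :=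
    (Finset.sum_eq_zero_iff_of_nonneg fun S _ =>
      integral_nonneg (gradInnerAt_self_nonneg u)).1 h T (Finset.mem_univ T)
  have hgu : Set.EqOn (gradInnerAt u u) (gradInnerAt g g) (interior (M.tet T)) := fun x hx => by
    simp only [gradInnerAt, (eventuallyEq_nhds hug hx).fderiv_eq]
  have hae : gradInnerAt g g =ᵐ[volume.restrict (interior (M.tet T))] 0 :=
    (hgu.aeEq_restrict isOpen_interior.measurableSet).symm.trans
      ((setIntegral_eq_zero_iff_of_nonneg_ae (.of_forall (gradInnerAt_self_nonneg u))
        (hu.integrableOn_gradInnerAt hu T)).1 hint)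
  have hzero := Measure.eqOn_open_of_ae_eq hae isOpen_interior
    (continuous_gradInnerAt hg hg).continuousOn continuousOn_const
  obtain ⟨c, hc⟩ := isOpen_interior.exists_is_const_of_fderiv_eq_zero
    (M.convex_tet T).interior.isPreconnected (hg.differentiable one_ne_zero).differentiableOn
    fun x hx => fderiv_eq_zero_of_gradInnerAt_self (hzero hx)
  exact ⟨c, fun x hx => (hug hx).trans (hc x hx)⟩

variable (M) {c : Fin M.nt → E3}

theorem mem_conformingP3_of_piecewise_const (hu : u ∈ M.velocitySpace)
    (hc : ∀ T, ∀ x ∈ interior (M.tet T), u x = c T) : u ∈ M.conformingP3 := by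
  obtain ⟨vc, hvc, d, rfl⟩ := M.mem_velocitySpace_iff.1 hu
  have hd (T : Fin M.nt) (i : Fin 9) : d (T, i) = 0 := by
    choose q hq hqe using hvc.2.2 T
    have hdeg (m : Fin 3) : (MvPolynomial.C (c T m) - q m).totalDegree < 4 := by
      refine ((MvPolynomial.totalDegree_sub _ _).trans (max_le ?_ ?_)).trans_lt
        (Nat.lt_succ_self 3)
      · rw [MvPolynomial.totalDegree_C]
        exact Nat.zero_le 3
      · exact (MvPolynomial.mem_restrictTotalDegree _ _ _).1 (hq m)
    refine bubble_coeff_eq_zero (M.basis T) (d := fun i => d (T, i)) hdeg isOpen_interior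
      (M.nonempty_interior_tet T) (fun x hx m => ?_) i
    rw [← M.sum_bubble_apply d hx, map_sub, MvPolynomial.eval_C, ← hqe m x (interior_subset hx),
      ← hc T x hx, Pi.add_apply, PiLp.add_apply, add_sub_cancel_left]
  rwa [Finset.sum_eq_zero fun Ti _ => by rw [hd Ti.1 Ti.2, zero_smul], add_zero]

theorem eq_zero_of_mem_conformingP3_of_piecewise_const (hconn : IsConnected Ω)
    (hreg : interior (closure Ω) = Ω) (hu : u ∈ M.conformingP3)
    (hc : ∀ T, ∀ x ∈ interior (M.tet T), u x = c T) : u = 0 := by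
  obtain ⟨hcont, hout, -⟩ := hu
  have hcT (T : Fin M.nt) : ∀ x ∈ M.tet T, u x = c T :=
    Set.EqOn.of_subset_closure (hc T) (hcont.mono (M.tet_subset T)) continuousOn_const
      interior_subset (M.closure_interior_tet T).symm.subset
  have hne (T : Fin M.nt) : (closure Ω ∩ M.tet T).Nonempty :=
    (M.nonempty_interior_tet T).mono fun x hx =>
      ⟨M.tet_subset T (interior_subset hx), interior_subset hx⟩
  have hcc (T T' : Fin M.nt) : c T = c T' :=
    eq_of_isPreconnected_of_closed_cover hconn.closure.isPreconnected
      (fun S => (M.isCompact_tet S).isClosed) M.iUnion_tet.symm.subset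
      (fun x _ S S' hS hS' => (hcT S x hS).symm.trans (hcT S' x hS')) (hne T) (hne T')
  obtain ⟨x, hx, hxΩ⟩ := nonempty_closure_diff_of_isCompact M.isCompact_closure hconn.nonempty
    (hreg ▸ isOpen_interior)
  obtain ⟨T₀, hT₀⟩ := M.exists_mem_tet hx
  have hc₀ : c T₀ = 0 := (hcT T₀ x hT₀).symm.trans (hout x hxΩ)
  funext y
  by_cases hy : y ∈ Ω
  · obtain ⟨T, hT⟩ := M.exists_mem_tet (subset_closure hy)
    exact (hcT T y hT).trans ((hcc T T₀).trans hc₀)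
  · exact hout y hy

theorem eq_zero_of_gradForm_self (hconn : IsConnected Ω) (hreg : interior (closure Ω) = Ω)
    (hu : u ∈ M.velocitySpace) (h : M.gradForm u u = 0) : u = 0 := by
  choose c hc using (M.piecewiseC1_of_mem_velocitySpace hu).exists_const_of_gradForm_self h
  exact M.eq_zero_of_mem_conformingP3_of_piecewise_const hconn hreg
    (M.mem_conformingP3_of_piecewise_const hu hc) hc

end TetMesh

namespace TetMesh

variable {Ω : Set E3} (M : TetMesh Ω)

theorem tet_eq_of_range {T : Fin M.nt} {b : AffineBasis (Fin 4) ℝ E3}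
    (hb : Set.range b = Set.range (M.vertex T)) : M.tet T = convexHull ℝ (Set.range b) := by
  rw [tet, hb]

theorem mem_tet_iff_of_range {T : Fin M.nt} {b : AffineBasis (Fin 4) ℝ E3}
    (hb : Set.range b = Set.range (M.vertex T)) {x : E3} :
    x ∈ M.tet T ↔ ∀ i, 0 ≤ b.coord i x := by
  rw [M.tet_eq_of_range hb, b.convexHull_eq_nonneg_coord, Set.mem_ofPred_eq]

theorem exists_affineBasis_agree_off {b : AffineBasis (Fin 4) ℝ E3} {S : Fin M.nt} {j : Fin 4}
    (h : ∀ i, i ≠ j → b i ∈ Set.range (M.vertex S)) :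
    ∃ b' : AffineBasis (Fin 4) ℝ E3, Set.range b' = Set.range (M.vertex S) ∧
      ∀ i, i ≠ j → b i = b' i := by
  choose! k hk using h
  have hinj : Set.InjOn k {j}ᶜ := fun i hi l hl hil =>
    b.ind.injective (by rw [← hk i hi, ← hk l hl, hil])
  obtain ⟨g, hg⟩ := Set.MapsTo.exists_equiv_extend_of_card_eq (t := Finset.univ)
    (Finset.card_univ (α := Fin 4)).symm (fun _ _ => Finset.mem_coe.2 (Finset.mem_univ _)) hinj
  let e : Fin 4 ≃ Fin 4 := g.trans (Equiv.subtypeUnivEquiv Finset.mem_univ)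
  refine ⟨(M.basis S).reindex e.symm, ?_, fun i hi => ?_⟩
  · rw [AffineBasis.coe_reindex]
    exact e.surjective.range_comp _
  · rw [AffineBasis.coe_reindex]
    exact (hk i hi).symm.trans (congrArg (M.vertex S) (hg i hi).symm)

/-- Two different tetrahedra with a common face, both numbered such that the vertices of the face
have the same numbers and the vertices opposite to it are number `apex`. -/
structure CommonFace (T T' : Fin M.nt) where
  ne : T ≠ T'
  apex : Fin 4
  left : AffineBasis (Fin 4) ℝ E3
  right : AffineBasis (Fin 4) ℝ E3
  range_left : Set.range left = Set.range (M.vertex T)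
  range_right : Set.range right = Set.range (M.vertex T')
  agree : ∀ i, i ≠ apex → left i = right i

namespace CommonFace

variable {M} {T T' : Fin M.nt} (F : M.CommonFace T T')

/-- The same face, with the two tetrahedra exchanged. -/
def symm : M.CommonFace T' T where
  ne := F.ne.symm
  apex := F.apex
  left := F.right
  right := F.left
  range_left := F.range_right
  range_right := F.range_left
  agree i hi := (F.agree i hi).symm

theorem coord_apex_eq_zero {x : E3} (hx : x ∈ M.tet T) (hx' : x ∈ M.tet T') :
    F.left.coord F.apex x = 0 := by
  refine M.coord_eq_zero_of_mem_inter F.ne F.range_left (fun hapex => ?_) hx hx'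
  obtain ⟨i, hi⟩ := M.exists_vertex_notMem F.ne
  obtain ⟨k, hk⟩ : M.vertex T i ∈ Set.range F.left := F.range_left ▸ ⟨i, rfl⟩
  rw [← hk] at hi
  obtain rfl | hne := eq_or_ne k F.apex
  · exact hi hapex
  · exact hi (F.range_right ▸ ⟨k, (F.agree k hne).symm⟩)

theorem coord_apex_right_neg : F.left.coord F.apex (F.right F.apex) < 0 :=
  coord_apex_neg F.agree fun _ hx => F.coord_apex_eq_zero (M.tet_eq_of_range F.range_left ▸ hx.1)
    (M.tet_eq_of_range F.range_right ▸ hx.2)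

theorem coord_left_eq_coord_right {x : E3} (hx : F.left.coord F.apex x = 0) {i : Fin 4}
    (hi : i ≠ F.apex) : F.left.coord i x = F.right.coord i x := by
  have hx' : F.right.coord F.apex x = 0 :=
    (mul_eq_zero.1 ((coord_apex_apply F.agree x).symm.trans hx)).resolve_left
      F.coord_apex_right_neg.ne
  rw [coord_apply_of_agree_off F.agree, if_neg hi, hx', zero_mul, add_zero]

-- A third tetrahedron on the face would have its apex strictly on the negative side of each of the
-- first two, which are on opposite sides of the face.
theorem exists_left_notMem {S : Fin M.nt} (hS : S ≠ T) (hS' : S ≠ T') :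
    ∃ i, i ≠ F.apex ∧ F.left i ∉ Set.range (M.vertex S) := by
  by_contra! hall
  obtain ⟨b, hb, hagree⟩ := M.exists_affineBasis_agree_off hall
  let G : M.CommonFace T S := ⟨hS.symm, F.apex, F.left, b, F.range_left, hb, hagree⟩
  let H : M.CommonFace T' S := ⟨hS'.symm, F.apex, F.right, b, F.range_right, hb,
    fun i hi => (F.agree i hi).symm.trans (hagree i hi)⟩
  have hG : F.left.coord F.apex (b F.apex) < 0 := G.coord_apex_right_neg
  rw [coord_apex_apply F.agree] at hG
  exact hG.not_gt (mul_pos_of_neg_of_neg F.coord_apex_right_neg H.coord_apex_right_neg)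

open Classical in
/-- The vector field with constant direction `w` whose size is the cubic bubble of the face on the
two tetrahedra, and zero on all others. -/
noncomputable def faceField (w x : E3) : E3 :=
  if x ∈ M.tet T then faceBubble F.left F.apex x • w
  else if x ∈ M.tet T' then faceBubble F.right F.apex x • w
  else 0

theorem faceField_of_mem {w x : E3} (hx : x ∈ M.tet T) :
    F.faceField w x = faceBubble F.left F.apex x • w :=
  if_pos hx

theorem faceField_symm (w : E3) : F.symm.faceField w = F.faceField w := by
  funext x
  by_cases hx : x ∈ M.tet T
  · rw [F.faceField_of_mem hx, faceField]
    split_ifs with hx'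
    · congr 1
      exact Finset.prod_congr rfl fun i hi => (F.coord_left_eq_coord_right
        (F.coord_apex_eq_zero hx hx') (Finset.ne_of_mem_erase hi)).symm
    · rfl
  · simp only [faceField, if_neg hx]
    rfl

theorem faceField_eq_zero_of_mem {S : Fin M.nt} (hS : S ≠ T) (hS' : S ≠ T') {w x : E3}
    (hx : x ∈ M.tet S) : F.faceField w x = 0 := by
  have hleft {T T' : Fin M.nt} (F : M.CommonFace T T') (hS : S ≠ T) (hS' : S ≠ T')
      (hxT : x ∈ M.tet T) : F.faceField w x = 0 := by
    obtain ⟨i, hi, hiS⟩ := F.exists_left_notMem hS hS'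
    rw [F.faceField_of_mem hxT, faceBubble,
      Finset.prod_eq_zero (Finset.mem_erase.2 ⟨hi, Finset.mem_univ i⟩)
        (M.coord_eq_zero_of_mem_inter hS.symm F.range_left hiS hxT hx), zero_smul]
  by_cases hxT : x ∈ M.tet T
  · exact hleft F hS hS' hxT
  by_cases hxT' : x ∈ M.tet T'
  · rw [← F.faceField_symm]
    exact hleft F.symm hS' hS hxT'
  · rw [faceField, if_neg hxT, if_neg hxT']

theorem mem_of_coord_pos (hreg : interior (closure Ω) = Ω) {x : E3}
    (hx : ∀ i, i ≠ F.apex → 0 < F.left.coord i x ∧ 0 < F.right.coord i x) : x ∈ Ω := by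
  let U : Set E3 := ⋂ i ∈ {i | i ≠ F.apex}, {y | 0 < F.left.coord i y ∧ 0 < F.right.coord i y}
  have hU : IsOpen U := (Set.toFinite _).isOpen_biInter fun i _ =>
    (isOpen_lt continuous_const (continuous_barycentric_coord F.left i)).inter
      (isOpen_lt continuous_const (continuous_barycentric_coord F.right i))
  have hUΩ : U ⊆ closure Ω := by
    intro y hy
    have hpos (i : Fin 4) (hi : i ≠ F.apex) := Set.mem_iInter₂.1 hy i hi
    obtain hapex | hapex := le_total 0 (F.left.coord F.apex y)
    · refine M.tet_subset T ((M.mem_tet_iff_of_range F.range_left).2 fun i => ?_)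
      obtain rfl | hi := eq_or_ne i F.apex
      exacts [hapex, (hpos i hi).1.le]
    · refine M.tet_subset T' ((M.mem_tet_iff_of_range F.range_right).2 fun i => ?_)
      obtain rfl | hi := eq_or_ne i F.apex
      · rw [coord_apex_apply F.agree] at hapex
        exact nonneg_of_mul_nonpos_right hapex F.coord_apex_right_neg
      · exact (hpos i hi).2.le
  rw [← hreg]
  exact interior_maximal hUΩ hU (Set.mem_iInter₂.2 hx)

theorem mem_of_faceBubble_ne_zero (hreg : interior (closure Ω) = Ω) {x : E3} (hx : x ∈ M.tet T)
    (h : faceBubble F.left F.apex x ≠ 0) : x ∈ Ω := by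
  have hnonneg := (M.mem_tet_iff_of_range F.range_left).1 hx
  have hpos (i : Fin 4) (hi : i ≠ F.apex) : 0 < F.left.coord i x :=
    (hnonneg i).lt_of_ne'
      (Finset.prod_ne_zero_iff.1 h i (Finset.mem_erase.2 ⟨hi, Finset.mem_univ i⟩))
  obtain hapex | hapex := (hnonneg F.apex).lt_or_eq
  · refine M.interior_tet_subset hreg T ?_
    rw [M.tet_eq_of_range F.range_left, F.left.interior_convexHull]
    intro i
    obtain rfl | hi := eq_or_ne i F.apex
    exacts [hapex, hpos i hi]
  · exact F.mem_of_coord_pos hreg fun i hi =>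
      ⟨hpos i hi, F.coord_left_eq_coord_right hapex.symm hi ▸ hpos i hi⟩

theorem faceField_eq_zero_of_notMem (hreg : interior (closure Ω) = Ω) (w : E3) {x : E3}
    (hx : x ∉ Ω) : F.faceField w x = 0 := by
  have hleft {T T' : Fin M.nt} (F : M.CommonFace T T') (hxT : x ∈ M.tet T) :
      F.faceField w x = 0 := by
    rw [F.faceField_of_mem hxT, not_imp_comm.1 (F.mem_of_faceBubble_ne_zero hreg hxT) hx,
      zero_smul]
  by_cases hxT : x ∈ M.tet T
  · exact hleft F hxT
  by_cases hxT' : x ∈ M.tet T'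
  · rw [← F.faceField_symm]
    exact hleft F.symm hxT'
  · rw [faceField, if_neg hxT, if_neg hxT']

theorem exists_mvPolynomial_eq_faceField (w : E3) (S : Fin M.nt) (m : Fin 3) :
    ∃ q ∈ MvPolynomial.restrictTotalDegree (Fin 3) ℝ 3,
      ∀ x ∈ M.tet S, F.faceField w x m = MvPolynomial.eval (fun k => x k) q := by
  have hleft {T T' : Fin M.nt} (F : M.CommonFace T T') :
      ∃ q ∈ MvPolynomial.restrictTotalDegree (Fin 3) ℝ 3,
        ∀ x ∈ M.tet T, F.faceField w x m = MvPolynomial.eval (fun k => x k) q := by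
    obtain ⟨q, hq, hqe⟩ := exists_mvPolynomial_eq_faceBubble F.left F.apex
    refine ⟨w m • q, Submodule.smul_mem _ _ hq, fun x hx => ?_⟩
    rw [F.faceField_of_mem hx, PiLp.smul_apply, hqe, MvPolynomial.smul_eval, smul_eq_mul, mul_comm]
  obtain rfl | hS := eq_or_ne S T
  · exact hleft F
  obtain rfl | hS' := eq_or_ne S T'
  · rw [← F.faceField_symm]
    exact hleft F.symm
  · refine ⟨0, Submodule.zero_mem _, fun x hx => ?_⟩
    rw [F.faceField_eq_zero_of_mem hS hS' hx, PiLp.zero_apply, map_zero]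

theorem faceField_mem_conformingP3 (hreg : interior (closure Ω) = Ω) (w : E3) :
    F.faceField w ∈ M.conformingP3 := by
  refine ⟨?_, fun x => F.faceField_eq_zero_of_notMem hreg w, F.exists_mvPolynomial_eq_faceField w⟩
  rw [← M.iUnion_tet]
  refine (locallyFinite_of_finite _).continuousOn_iUnion
    (fun S => (M.isCompact_tet S).isClosed) fun S => ?_
  choose q _ hq using F.exists_mvPolynomial_eq_faceField w S
  exact (PiLp.continuous_toLp 2 _).comp_continuousOn <| continuousOn_pi.2 fun m =>
    ((MvPolynomial.continuous_eval (q m)).comp (PiLp.continuous_ofLp 2 _)).continuousOn.congr (hq m)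

theorem setIntegral_divAt_faceField (w : E3) :
    ∫ x in interior (M.tet T), divAt (F.faceField w) x =
      -(1 / 20 * volume.real (interior (M.tet T)) * (F.left.coord F.apex).linear w) := by
  have hdiv : Set.EqOn (divAt (F.faceField w))
      (fun x => fderiv ℝ (faceBubble F.left F.apex) x w) (interior (M.tet T)) := fun x hx => by
    have heq : F.faceField w =ᶠ[nhds x] fun y => faceBubble F.left F.apex y • w :=
      eventuallyEq_nhds (fun y hy => F.faceField_of_mem (interior_subset hy)) hx
    have h := divAt_sum_smul (s := {()}) (φ := fun _ => faceBubble F.left F.apex) (w := fun _ => w)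
      fun _ _ => (contDiff_faceBubble (n := 1)).differentiable one_ne_zero x
    simp only [Finset.sum_singleton] at h
    rw [divAt, heq.fderiv_eq]
    exact h
  rw [setIntegral_congr_fun isOpen_interior.measurableSet hdiv, M.tet_eq_of_range F.range_left,
    setIntegral_fderiv_faceBubble]
  norm_num [Nat.factorial]

theorem setIntegral_divAt_faceField_right (w : E3) :
    ∫ x in interior (M.tet T'), divAt (F.faceField w) x =
      -∫ x in interior (M.tet T), divAt (F.faceField w) x := by
  have hvol := measureReal_interior_convexHull_of_agree_off volume F.agree
  rw [← M.tet_eq_of_range F.range_left, ← M.tet_eq_of_range F.range_right,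
    abs_of_neg F.coord_apex_right_neg] at hvol
  rw [F.setIntegral_divAt_faceField, ← F.faceField_symm, F.symm.setIntegral_divAt_faceField,
    coord_linear_apex_apply F.agree, hvol]
  change -(_ * _ * (F.right.coord F.apex).linear w) = _
  ring

end CommonFace

end TetMesh

namespace TetMesh

variable {Ω : Set E3} {M : TetMesh Ω} {c : Fin M.nt → ℝ}

theorem CommonFace.const_eq_of_orthogonal {T T' : Fin M.nt} (F : M.CommonFace T T')
    (hreg : interior (closure Ω) = Ω)
    (horth : ∀ v ∈ M.conformingP3, ∑ S, c S * ∫ x in interior (M.tet S), divAt v x = 0) :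
    c T = c T' := by
  obtain ⟨k, hk⟩ := exists_ne F.apex
  have hw : (F.left.coord F.apex).linear (F.left F.apex - F.left k) = 1 := by
    rw [coord_linear_sub, if_pos rfl, if_neg hk.symm, sub_zero]
  have hI := F.setIntegral_divAt_faceField (F.left F.apex - F.left k)
  have h := horth _ (F.faceField_mem_conformingP3 hreg (F.left F.apex - F.left k))
  rw [Fintype.sum_eq_add T T' F.ne, F.setIntegral_divAt_faceField_right, mul_neg,
    ← sub_eq_add_neg, ← sub_mul] at h
  · have hvol : 0 < volume.real (interior (M.tet T)) :=
      measureReal_interior_convexHull_pos (M.basis T)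
    refine sub_eq_zero.1 ((mul_eq_zero.1 h).resolve_right ?_)
    rw [hI, hw]
    linarith
  · rintro S ⟨hS, hS'⟩
    rw [setIntegral_eq_zero_of_forall_eq_zero fun x hx => ?_, mul_zero]
    have hzero : F.faceField (F.left F.apex - F.left k) =ᶠ[nhds x] fun _ => 0 :=
      eventuallyEq_nhds
        (fun y hy => F.faceField_eq_zero_of_mem hS hS' (interior_subset hy)) hx
    simp [divAt, hzero.fderiv_eq]

variable (M)

/-- The line through the vertices `i` and `j` of the tetrahedron `S`, degenerate for `i = j`. -/
noncomputable def edgeLine (e : Fin M.nt × Fin 4 × Fin 4) : AffineSubspace ℝ E3 :=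
  affineSpan ℝ {M.vertex e.1 e.2.1, M.vertex e.1 e.2.2}

theorem finrank_direction_edgeLine_le (e : Fin M.nt × Fin 4 × Fin 4) :
    Module.finrank ℝ (M.edgeLine e).direction ≤ 1 := by
  rw [edgeLine, direction_affineSpan]
  exact collinear_iff_finrank_le_one.1 (collinear_pair ℝ _ _)

theorem nonempty_commonFace {T T' : Fin M.nt} (hne : T ≠ T') {x : E3} (hx : x ∈ M.tet T)
    (hx' : x ∈ M.tet T') (hedge : x ∉ ⋃ e, (M.edgeLine e : Set E3)) :
    Nonempty (M.CommonFace T T') := by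
  obtain ⟨j, hj⟩ := M.exists_vertex_notMem hne
  have hcommon (i : Fin 4) (hi : i ≠ j) : M.vertex T i ∈ Set.range (M.vertex T') := by
    by_contra hnotMem
    have hpair : ∀ i j : Fin 4, i ≠ j → ∃ k l, ∀ m, m ≠ i → m ≠ j → m = k ∨ m = l := by decide
    obtain ⟨k, l, hkl⟩ := hpair i j hi
    have hsub : Set.range (M.vertex T) ∩ Set.range (M.vertex T') ⊆
        {M.vertex T k, M.vertex T l} := by
      rintro _ ⟨⟨m, rfl⟩, hm⟩
      obtain rfl | rfl := hkl m (fun h => hnotMem (h ▸ hm)) (fun h => hj (h ▸ hm))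
      exacts [Set.mem_insert _ _, Set.mem_insert_of_mem _ rfl]
    have hmem : x ∈ convexHull ℝ (Set.range (M.vertex T) ∩ Set.range (M.vertex T')) := by
      rw [← M.inter_eq T T' hne]
      exact ⟨hx, hx'⟩
    exact hedge (Set.mem_iUnion.2
      ⟨(T, k, l), convexHull_subset_affineSpan _ (convexHull_mono hsub hmem)⟩)
  obtain ⟨b, hb, hagree⟩ := M.exists_affineBasis_agree_off (b := M.basis T) hcommon
  exact ⟨⟨hne, j, M.basis T, b, rfl, hb, hagree⟩⟩

theorem const_eq_of_orthogonal (hconn : IsConnected Ω) (hreg : interior (closure Ω) = Ω)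
    (horth : ∀ v ∈ M.conformingP3, ∑ S, c S * ∫ x in interior (M.tet S), divAt v x = 0)
    (T T' : Fin M.nt) : c T = c T' := by
  have hrank (e : Fin M.nt × Fin 4 × Fin 4) :
      Module.finrank ℝ (M.edgeLine e).direction + 1 < Module.finrank ℝ E3 := by
    have := M.finrank_direction_edgeLine_le e
    rw [finrank_euclideanSpace_fin]
    omega
  have hne_top (e : Fin M.nt × Fin 4 × Fin 4) : M.edgeLine e ≠ ⊤ := fun h => by
    have := hrank e
    rw [h, AffineSubspace.direction_top, finrank_top] at this
    omega
  have hpre := isPreconnected_diff_iUnion_affineSubspace (hreg ▸ isOpen_interior)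
    hconn.isPreconnected hrank
  have hne (S : Fin M.nt) :
      ((Ω \ ⋃ e, (M.edgeLine e : Set E3)) ∩ M.tet S).Nonempty := by
    obtain ⟨x, hxS, hx⟩ := (dense_compl_iUnion_affineSubspace hne_top).inter_open_nonempty _
      isOpen_interior (M.nonempty_interior_tet S)
    exact ⟨x, ⟨M.interior_tet_subset hreg S hxS, hx⟩, interior_subset hxS⟩
  refine eq_of_isPreconnected_of_closed_cover hpre (fun S => (M.isCompact_tet S).isClosed)
    (Set.sdiff_subset.trans (M.iUnion_tet ▸ subset_closure)) (fun x hx S S' hS hS' => ?_)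
    (hne T) (hne T')
  obtain rfl | hSS' := eq_or_ne S S'
  · rfl
  · obtain ⟨F⟩ := M.nonempty_commonFace hSS' hS hS' hx.2
    exact F.const_eq_of_orthogonal hreg horth

theorem divForm_bubble (T : Fin M.nt) (i : Fin 9) (p : E3 → ℝ) :
    M.divForm (M.bubble T i) p = ∫ x in interior (M.tet T),
      divAt (mappedBubble fun k => M.basis T (renumbering i k)) x * p x := by
  rw [divForm, Fintype.sum_eq_single T]
  · refine setIntegral_congr_fun isOpen_interior.measurableSet fun x hx => ?_
    simp only [divAt, (eventuallyEq_nhds (fun _ hy => M.bubble_apply_self i hy) hx).fderiv_eq]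
  · refine fun S hS => setIntegral_eq_zero_of_forall_eq_zero fun x hx => ?_
    have hzero : M.bubble T i =ᶠ[nhds x] fun _ => 0 :=
      eventuallyEq_nhds (fun y hy => M.bubble_apply_of_ne hS.symm i hy) hx
    simp [divAt, hzero.fderiv_eq]

section Pressure

variable {M} {p : E3 → ℝ}

theorem ae_interior_of_ae (hreg : interior (closure Ω) = Ω) {T : Fin M.nt} {r : E3 → ℝ}
    (h : ∀ᵐ x ∂(volume.restrict Ω), x ∈ M.tet T → p x = r x) :
    p =ᵐ[volume.restrict (interior (M.tet T))] r := by
  filter_upwards [ae_restrict_of_ae_restrict_of_subset (M.interior_tet_subset hreg T) h,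
    ae_restrict_mem isOpen_interior.measurableSet] with x hx hxT
  exact hx (interior_subset hxT)

theorem exists_ae_eq_const_of_divForm_bubble (hreg : interior (closure Ω) = Ω) {T : Fin M.nt}
    {q : MvPolynomial (Fin 3) ℝ} (hq : q ∈ MvPolynomial.restrictTotalDegree (Fin 3) ℝ 2)
    (hpq : ∀ᵐ x ∂(volume.restrict Ω), x ∈ M.tet T → p x = MvPolynomial.eval (fun k => x k) q)
    (horth : ∀ i, M.divForm (M.bubble T i) p = 0) :
    ∃ c, ∀ᵐ x ∂(volume.restrict Ω), x ∈ M.tet T → p x = c := by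
  obtain ⟨c, hc⟩ := eval_eq_const_of_orthogonal_bubbles (M.basis T) hq fun i => by
    rw [← horth i, divForm_bubble]
    refine integral_congr_ae ?_
    filter_upwards [ae_interior_of_ae hreg hpq] with x hx
    rw [hx]
  refine ⟨c, ?_⟩
  filter_upwards [hpq] with x hx hxT
  rw [hx hxT, hc]

theorem divForm_of_piecewise_const (hreg : interior (closure Ω) = Ω)
    (hc : ∀ T, ∀ᵐ x ∂(volume.restrict Ω), x ∈ M.tet T → p x = c T) (v : E3 → E3) :
    M.divForm v p = ∑ T, c T * ∫ x in interior (M.tet T), divAt v x := by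
  refine Finset.sum_congr rfl fun T _ => ?_
  rw [← integral_const_mul]
  refine integral_congr_ae ?_
  filter_upwards [ae_interior_of_ae (r := fun _ => c T) hreg (hc T)] with x hx
  rw [hx, mul_comm]

end Pressure

theorem eq_zero_of_divForm_eq_zero (hconn : IsConnected Ω) (hreg : interior (closure Ω) = Ω)
    {p : Lp ℝ 2 (volume.restrict Ω)} (hp : p ∈ M.pressureSpace)
    (h : ∀ v ∈ M.velocitySpace, M.divForm v p = 0) : p = 0 := by
  obtain ⟨⟨-, hmean⟩, hpoly⟩ := hp
  choose q hq hpq using hpoly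
  choose c hc using fun T => exists_ae_eq_const_of_divForm_bubble hreg (hq T) (hpq T)
    fun i => h _ (M.bubble_mem_velocitySpace T i)
  have hcc := M.const_eq_of_orthogonal hconn hreg fun v hv =>
    (divForm_of_piecewise_const hreg hc v).symm.trans (h v (Submodule.mem_sup_left hv))
  obtain ⟨x₀, hx₀⟩ := hconn.nonempty
  obtain ⟨T₀, -⟩ := M.exists_mem_tet (subset_closure hx₀)
  have hconst : ∀ᵐ x ∂(volume.restrict Ω), p x = c T₀ := by
    filter_upwards [ae_all_iff.2 hc, M.ae_exists_mem_tet] with x hx ⟨T, hT⟩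
    rw [hx T hT, hcc T T₀]
  have hvol : volume.real Ω ≠ 0 := ENNReal.toReal_ne_zero.2
    ⟨((hreg ▸ isOpen_interior : IsOpen Ω).measure_pos volume hconn.nonempty).ne',
      ((measure_mono subset_closure).trans_lt M.isCompact_closure.measure_lt_top).ne⟩
  rw [integral_congr_ae hconst, setIntegral_const, smul_eq_mul] at hmean
  rw [(mul_eq_zero.1 hmean).resolve_left hvol] at hconst
  exact (Lp.eq_zero_iff_ae_eq_zero).2 hconst

end TetMesh

theorem lemma3p2 (Ω : Set E3) (hconn : IsConnected Ω) (hreg : interior (closure Ω) = Ω)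
    (M : TetMesh Ω) (f : Lp E3 2 (volume.restrict Ω)) :
    ∃! up : M.velocitySpace × M.pressureSpace, M.IsDiscreteStokesSolution f up.1 up.2 := by
  have h := existsUnique_saddlePoint M.gradBilin (M.divBilin hreg) (M.loadFunctional f)
    (fun u hu => Subtype.ext (M.eq_zero_of_gradForm_self hconn hreg u.2 hu))
    (fun p hp => Subtype.ext (M.eq_zero_of_divForm_eq_zero hconn hreg p.2 fun v hv => hp ⟨v, hv⟩))
  refine (existsUnique_congr fun up => ?_).1 h
  exact ⟨fun h => ⟨fun v hv => h.1 ⟨v, hv⟩, fun q hq => h.2 ⟨q, hq⟩⟩,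
    fun h => ⟨fun v => h.1 v v.2, fun q => h.2 q q.2⟩⟩
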